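/- Let $q$ and $\Delta\ge 0$ be real-valued functions that are continuous on $[0,\frac{\pi}{2})$ and on $(\frac{\pi}{2},\pi]$ and have finite one-sided limits at $\frac{\pi}{2}$, and let $x-\Delta(x)\ge 0$ for $x\in[0,\frac{\pi}{2})$ and $x-\Delta(x)\ge\frac{\pi}{2}$ for $x\in(\frac{\pi}{2},\pi]$. Let $a_1,a_1',a_2,a_2',b,\delta$ be real numbers with $a_2'\neq0$, $\delta\ne0$, $\sin b\neq0$. Consider, with the complex eigenparameter $\mu$, the problem $$y''(x)+q(x)\,y(x-\Delta(x))=-\mu^2y(x),\qquad x\in[0,\tfrac{\pi}{2})\cup(\tfrac{\pi}{2},\pi],$$ $$(\mu a_1'+a_1)y(0)-(\mu a_2'+a_2)y'(0)=0,\qquad \cos b\;y(\pi)+\mu\sin b\;y'(\pi)=0,$$ $$y(\tfrac{\pi}{2}-0)=\delta\,y(\tfrac{\pi}{2}+0),\qquad y'(\tfrac{\pi}{2}-0)=\delta\,y'(\tfrac{\pi}{2}+0),$$ where $y$ and $y'$ have finite one-sided limits at $\frac{\pi}{2}$, and for $x>\frac{\pi}{2}$ with $x-\Delta(x)=\frac{\pi}{2}$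 the symbol $y(x-\Delta(x))$ means $y(\frac{\pi}{2}+0)$. A number $\mu\in\mathbb{C}$ is an eigenvalue if the problem has a nontrivial complex-valued solution. For each $\mu\in\mathbb C$ let $\omega(\cdot,\mu)$ be the solution of the equation and of the two interface conditions with $\omega(0,\mu)=\mu a_2'+a_2$, $\omega'(0,\mu)=\mu a_1'+a_1$, and let $F(\mu)=\cos b\,\omega(\pi,\mu)+\mu\sin b\,\omega'(\pi,\mu)$. Then $\omega(\cdot,\mu)$ exists, $F$ is well defined and entire, and the eigenvalues, which are the zeros of $F$, can be enumerated, each repeated according to its multiplicity as a zero of $F$, as $\mu_{\pm0},\mu_{\pm1},\mu_{\pm2},\dots$ in such a way that, as $n\to\infty$, with either choice of the sign, $$\mu_{\pm n}=\mu_{\pm n}^0-\frac{1}{\mu_{\pm n}^0\,\pi}\left(-\frac{a_1'}{a_2'}+P(\mu_{\pm n}^0,\Delta)+Q(\mu_{\pm n}^0,\Delta)\right)+O\!\left(\frac1{n^2}\right).$$ Here $\mu^0_{\pm 0}=0$ and $\mu^0_{\pm n}=\pm(n-1)$ for $n\ge1$ are the zeros, with multiplicity, of $F_0(\mu)=-\frac{\mu^3a_2'}{\delta}\sin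 b\,\sin\mu\pi$, and $$P(\mu,\Delta)=\frac12\int_0^\pi q(\theta)\cos\bigl(\mu\Delta(\theta)\bigr)\,d\theta,\qquad Q(\mu,\Delta)=\frac12\int_0^\pi q(\theta)\cos\bigl(\mu(2\theta-\Delta(\theta))\bigr)\,d\theta .$$ -/

import Mathlib

open scoped Real Topology

/-- `f` is continuous on `[0, π/2)` and on `(π/2, π]` and has finite one-sided limits at `π/2`.
The value of `f` at `π/2` plays no role. -/
structure IsPiecewiseContinuous (f : ℝ → ℝ) : Prop where
  continuousOn_left : ContinuousOn f (Set.Ico 0 (π / 2))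
  continuousOn_right : ContinuousOn f (Set.Ioc (π / 2) π)
  limit_left : ∃ l : ℝ, Filter.Tendsto f (𝓝[<] (π / 2)) (𝓝 l)
  limit_right : ∃ l : ℝ, Filter.Tendsto f (𝓝[>] (π / 2)) (𝓝 l)

/-- The standing assumptions on the retardation `Δ`. -/
structure IsRetardation (Δ : ℝ → ℝ) : Prop where
  piecewise : IsPiecewiseContinuous Δ
  nonneg_left : ∀ x ∈ Set.Ico 0 (π / 2), 0 ≤ Δ x
  nonneg_right : ∀ x ∈ Set.Ioc (π / 2) π, 0 ≤ Δ x
  left : ∀ x ∈ Set.Ico 0 (π / 2), 0 ≤ x - Δ x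
  right : ∀ x ∈ Set.Ioc (π / 2) π, π / 2 ≤ x - Δ x

/-- A complex-valued function `y` on `[0, π/2) ∪ (π/2, π]` with its derivative, given by its two
pieces, each of them extended to `π/2` by the corresponding one-sided limit:
`left`, `left'` are `y`, `y'` on `[0, π/2]` and `right`, `right'` are `y`, `y'` on `[π/2, π]`.
Values outside these intervals play no role. -/
structure TwoPiece where
  left : ℝ → ℂ
  left' : ℝ → ℂ
  right : ℝ → ℂ
  right' : ℝ → ℂ

/-- `y` solves `y''(x) + q(x) y(x - Δ(x)) = -μ² y(x)` on `[0, π/2) ∪ (π/2, π]`, where `y` and `y'`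
have finite one-sided limits at `π/2`. -/
structure TwoPiece.SolvesEquation (y : TwoPiece) (q Δ : ℝ → ℝ) (μ : ℂ) : Prop where
  deriv_left : ∀ x ∈ Set.Icc 0 (π / 2),
    HasDerivWithinAt y.left (y.left' x) (Set.Icc 0 (π / 2)) x
  deriv_right : ∀ x ∈ Set.Icc (π / 2) π,
    HasDerivWithinAt y.right (y.right' x) (Set.Icc (π / 2) π) x
  continuousOn_left' : ContinuousOn y.left' (Set.Icc 0 (π / 2))
  continuousOn_right' : ContinuousOn y.right' (Set.Icc (π / 2) π)
  equation_left : ∀ x ∈ Set.Ico 0 (π / 2),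
    HasDerivWithinAt y.left' (-μ ^ 2 * y.left x - (q x : ℂ) * y.left (x - Δ x))
      (Set.Ico 0 (π / 2)) x
  equation_right : ∀ x ∈ Set.Ioc (π / 2) π,
    HasDerivWithinAt y.right' (-μ ^ 2 * y.right x - (q x : ℂ) * y.right (x - Δ x))
      (Set.Ioc (π / 2) π) x

/-- The interface conditions `y(π/2 - 0) = δ y(π/2 + 0)`, `y'(π/2 - 0) = δ y'(π/2 + 0)`. -/
def TwoPiece.Interface (y : TwoPiece) (δ : ℝ) : Prop :=
  y.left (π / 2) = (δ : ℂ) * y.right (π / 2) ∧ y.left' (π / 2) = (δ : ℂ) * y.right' (π / 2)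

/-- `y` is not identically zero on `[0, π/2] ∪ [π/2, π]`. -/
def TwoPiece.Nontrivial (y : TwoPiece) : Prop :=
  (∃ x ∈ Set.Icc 0 (π / 2), y.left x ≠ 0) ∨ (∃ x ∈ Set.Icc (π / 2) π, y.right x ≠ 0)

/-- The left-hand side `cos b · y(π) + μ sin b · y'(π)` of the boundary condition at `π`. -/
noncomputable def TwoPiece.endForm (y : TwoPiece) (b : ℝ) (μ : ℂ) : ℂ :=
  (Real.cos b : ℂ) * y.right π + μ * (Real.sin b : ℂ) * y.right' π

/-- `μ` is an eigenvalue: the boundary value problem with the interface conditions has a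
nontrivial solution for this `μ`. -/
def IsEigenvalue (q Δ : ℝ → ℝ) (a₁ a₁' a₂ a₂' b δ : ℝ) (μ : ℂ) : Prop :=
  ∃ y : TwoPiece, y.Nontrivial ∧ y.SolvesEquation q Δ μ ∧ y.Interface δ ∧
    (μ * a₁' + a₁) * y.left 0 - (μ * a₂' + a₂) * y.left' 0 = 0 ∧
    y.endForm b μ = 0

/-- `ω` is the solution `ω(·, μ)` of the equation and the interface conditions with
`ω(0, μ) = μ a₂' + a₂` and `ω'(0, μ) = μ a₁' + a₁`. -/
structure IsInitialSolution (q Δ : ℝ → ℝ) (a₁ a₁' a₂ a₂' δ : ℝ) (μ : ℂ) (ω : TwoPiece) :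
    Prop where
  solves : ω.SolvesEquation q Δ μ
  interface : ω.Interface δ
  value_zero : ω.left 0 = μ * a₂' + a₂
  deriv_zero : ω.left' 0 = μ * a₁' + a₁

/-- `F` is the characteristic function `F(μ) = cos b · ω(π, μ) + μ sin b · ω'(π, μ)`; this includes
that `ω(·, μ)` exists for every `μ` and that `F(μ)` does not depend on the choice of it. -/
def IsCharacteristicFunction (q Δ : ℝ → ℝ) (a₁ a₁' a₂ a₂' b δ : ℝ) (F : ℂ → ℂ) : Prop :=
  ∀ μ : ℂ, (∃ ω : TwoPiece, IsInitialSolution q Δ a₁ a₁' a₂ a₂' δ μ ω) ∧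
    ∀ ω : TwoPiece, IsInitialSolution q Δ a₁ a₁' a₂ a₂' δ μ ω → F μ = ω.endForm b μ

/-- `P(μ, Δ) = ½ ∫₀^π q(θ) cos (μ Δ(θ)) dθ`. -/
noncomputable def coefP (q Δ : ℝ → ℝ) (μ : ℝ) : ℝ :=
  1 / 2 * ∫ θ in (0 : ℝ)..π, q θ * Real.cos (μ * Δ θ)

/-- `Q(μ, Δ) = ½ ∫₀^π q(θ) cos (μ (2 θ - Δ(θ))) dθ`. -/
noncomputable def coefQ (q Δ : ℝ → ℝ) (μ : ℝ) : ℝ :=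
  1 / 2 * ∫ θ in (0 : ℝ)..π, q θ * Real.cos (μ * (2 * θ - Δ θ))

/-- The zeros of `F₀(μ) = -(μ³ a₂' / δ) sin b sin (μ π)`, indexed by a sign and a natural number,
that is by `±0, ±1, ±2, …`: the fourfold zero `0` has the indices `±0, ±1`, and for `n ≥ 1` the
index `±n` belongs to `±(n - 1)`. -/
noncomputable def unperturbed (s : ℤˣ) (n : ℕ) : ℝ :=
  if n = 0 then 0 else ((s : ℤ) : ℝ) * ((n : ℝ) - 1)

/-!
The interface conditions are compatible with the equation up to the constant `δ`: the function equal
to `y` before `π / 2` and to `δ y` after it is a continuously differentiable solution on `[0, π]` of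
one retarded equation, because the retarded argument never crosses `π / 2`. As a first order system
in integrated form this is `(u, v) = (A, B) + T_μ (u, v)` with a Volterra operator `T_μ` on
continuous functions that is polynomial in `μ`. Some power of `T_μ` has norm less than `1`, so
`1 - T_μ` is invertible; this gives existence, uniqueness and, since inversion is analytic, the
entire dependence on `μ` (`eq_systemSolution_iff`, `differentiable_systemSolution`). Hence the
characteristic function `F` (`endValue`) is entire, and its zeros are the eigenvalues
(`isEigenvalue_iff_endValue_eq_zero`).

Variation of constants bounds the solution by `C |μ| e^{x |Im μ|}` for large `|μ|`, and inserting
this bound into the same formula gives (`exists_expansion`)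
`δ F(μ) = sin b (-μ³ a₂' sin μπ + μ² (a₁' cos μπ - a₂ sin μπ - a₂' I(μ))) + O(μ e^{π |Im μ|})`,
where `I(μ) = ∫₀^π q(τ) cos μ(π - τ) cos μ(τ - Δ(τ)) dτ` is Lipschitz in strips around the real axis
and `I(m) = cos mπ (P(m) + Q(m))` at integers `m`.

By Rouché's theorem on circles (`card_zeros_eq_of_norm_sub_lt`), applied with the leading term, for
some `N` the disc `|μ| < N + 1/2` contains `2 N + 4` zeros of `F`, and the other zeros are simple,
one near each integer `m` with `|m| > N` (`exists_zeros_of_asymptotics`). The `2 N + 4` zeros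
receive the indices `±0, …, ±(N + 1)`, and the zero near `±(n - 1)` receives the index `±n`.
For a zero `m + ε` near `m` the leading term forces `ε = O(1 / m)`; the expansion divided by `μ²`
then reads `-m a₂' π ε + a₁' - a₂' (P(m) + Q(m)) = O(1 / m)`, which is the asserted asymptotic
formula (`exists_norm_zero_sub_le`).
-/

/-! ### Piecewise continuous coefficients and the retarded argument -/

theorem ContinuousOn.exists_continuous_eqOn_Icc {a c : ℝ} (hac : a ≤ c) {f : ℝ → ℝ}
    (hf : ContinuousOn f (Set.Icc a c)) :
    ∃ g : ℝ → ℝ, Continuous g ∧ Set.EqOn f g (Set.Icc a c) :=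
  ⟨Set.IccExtend hac ((Set.Icc a c).domRestrict f),
    (continuousOn_iff_continuous_domRestrict.1 hf).Icc_extend',
    fun x hx => by rw [Set.IccExtend_of_mem _ _ hx]; rfl⟩

theorem intervalIntegrable_of_eqOn_continuous {E : Type*} [NormedAddCommGroup E] {f g k : ℝ → E}
    (hg : Continuous g) (hk : Continuous k) (hfg : Set.EqOn f g (Set.Ico 0 (π / 2)))
    (hfk : Set.EqOn f k (Set.Ioc (π / 2) π)) :
    IntervalIntegrable f MeasureTheory.volume 0 π := by
  have h0 : (0 : ℝ) ≤ π / 2 := by positivity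
  have h1 : π / 2 ≤ π := by linarith [Real.pi_pos]
  refine IntervalIntegrable.trans (b := π / 2) ?_ ?_
  · refine (hg.intervalIntegrable 0 (π / 2)).congr_ae ?_
    rw [Set.uIoc_of_le h0, ← MeasureTheory.restrict_Ioo_eq_restrict_Ioc]
    exact (MeasureTheory.ae_restrict_iff' measurableSet_Ioo).2
      (Filter.Eventually.of_forall fun x hx => (hfg ⟨hx.1.le, hx.2⟩).symm)
  · refine (hk.intervalIntegrable (π / 2) π).congr fun x hx => ?_
    rw [Set.uIoc_of_le h1] at hx
    exact (hfk hx).symm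

namespace IsPiecewiseContinuous

variable {f : ℝ → ℝ}

theorem exists_continuous_left (hf : IsPiecewiseContinuous f) :
    ∃ g : ℝ → ℝ, Continuous g ∧ Set.EqOn f g (Set.Ico 0 (π / 2)) := by
  obtain ⟨l, hl⟩ := hf.limit_left
  have hs : Set.Icc (0 : ℝ) (π / 2) \ {π / 2} = Set.Ico 0 (π / 2) := Set.Icc_sdiff_right
  have h : ContinuousOn (Function.update f (π / 2) l) (Set.Icc 0 (π / 2)) := by
    rw [continuousOn_update_iff, hs]
    exact ⟨hf.continuousOn_left, fun _ => hl.mono_left (nhdsWithin_mono _ fun x hx => hx.2)⟩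
  obtain ⟨g, hg, hfg⟩ := h.exists_continuous_eqOn_Icc (by positivity)
  refine ⟨g, hg, fun x hx => ?_⟩
  rw [← hfg ⟨hx.1, hx.2.le⟩, Function.update_of_ne hx.2.ne]

theorem exists_continuous_right (hf : IsPiecewiseContinuous f) :
    ∃ g : ℝ → ℝ, Continuous g ∧ Set.EqOn f g (Set.Ioc (π / 2) π) := by
  obtain ⟨l, hl⟩ := hf.limit_right
  have hs : Set.Icc (π / 2) π \ {π / 2} = Set.Ioc (π / 2) π := Set.Icc_sdiff_left
  have h : ContinuousOn (Function.update f (π / 2) l) (Set.Icc (π / 2) π) := by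
    rw [continuousOn_update_iff, hs]
    exact ⟨hf.continuousOn_right, fun _ => hl.mono_left (nhdsWithin_mono _ fun x hx => hx.1)⟩
  obtain ⟨g, hg, hfg⟩ := h.exists_continuous_eqOn_Icc (by linarith [Real.pi_pos])
  refine ⟨g, hg, fun x hx => ?_⟩
  rw [← hfg ⟨hx.1.le, hx.2⟩, Function.update_of_ne hx.1.ne']

theorem exists_bound (hf : IsPiecewiseContinuous f) :
    ∃ K : ℝ, 0 < K ∧ ∀ x ∈ Set.Icc 0 π, |f x| ≤ K := by
  obtain ⟨g, hg, hfg⟩ := hf.exists_continuous_left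
  obtain ⟨k, hk, hfk⟩ := hf.exists_continuous_right
  obtain ⟨A, hA⟩ := isCompact_Icc.exists_bound_of_continuousOn (s := Set.Icc 0 π) hg.continuousOn
  obtain ⟨B, hB⟩ := isCompact_Icc.exists_bound_of_continuousOn (s := Set.Icc 0 π) hk.continuousOn
  refine ⟨max (max A B) (max |f (π / 2)| 1), by positivity, fun x hx => ?_⟩
  rcases lt_trichotomy x (π / 2) with h | h | h
  · rw [hfg ⟨hx.1, h⟩]
    exact (hA x hx).trans (by simp)
  · rw [h]; simp
  · rw [hfk ⟨h, hx.2⟩]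
    exact (hB x hx).trans (by simp)

/-- The integrands of `coefP` and `coefQ` are of this form. -/
theorem intervalIntegrable_mul_cos (hf : IsPiecewiseContinuous f) {d : ℝ → ℝ}
    (hd : IsPiecewiseContinuous d) (a c : ℝ) :
    IntervalIntegrable (fun θ => f θ * Real.cos (a * θ + c * d θ)) MeasureTheory.volume 0 π := by
  obtain ⟨g, hg, hfg⟩ := hf.exists_continuous_left
  obtain ⟨k, hk, hfk⟩ := hf.exists_continuous_right
  obtain ⟨g', hg', hfg'⟩ := hd.exists_continuous_left
  obtain ⟨k', hk', hfk'⟩ := hd.exists_continuous_right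
  refine intervalIntegrable_of_eqOn_continuous
    (g := fun θ => g θ * Real.cos (a * θ + c * g' θ))
    (k := fun θ => k θ * Real.cos (a * θ + c * k' θ)) (by fun_prop) (by fun_prop)
    (fun θ hθ => ?_) (fun θ hθ => ?_)
  · simp only [hfg hθ, hfg' hθ]
  · simp only [hfk hθ, hfk' hθ]

end IsPiecewiseContinuous

/-- The retarded argument `τ - Δ τ`, with the value `π / 2` at `π / 2`. The equation does not
constrain this value; the present choice makes the argument stay in `[0, τ]` for all
`τ ∈ [0, π]`. -/
noncomputable def retardedArg (Δ : ℝ → ℝ) (τ : ℝ) : ℝ := if τ = π / 2 then π / 2 else τ - Δ τ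

theorem retardedArg_of_ne {Δ : ℝ → ℝ} {τ : ℝ} (h : τ ≠ π / 2) : retardedArg Δ τ = τ - Δ τ :=
  if_neg h

theorem IsRetardation.retardedArg_mem_left {Δ : ℝ → ℝ} (hΔ : IsRetardation Δ) {τ : ℝ}
    (h : τ ∈ Set.Icc 0 (π / 2)) : retardedArg Δ τ ∈ Set.Icc 0 τ := by
  rcases h.2.lt_or_eq with h2 | h2
  · rw [retardedArg_of_ne h2.ne]
    exact ⟨hΔ.left τ ⟨h.1, h2⟩, by linarith [hΔ.nonneg_left τ ⟨h.1, h2⟩]⟩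
  · subst h2; simpa [retardedArg] using h.1

theorem IsRetardation.retardedArg_mem_right {Δ : ℝ → ℝ} (hΔ : IsRetardation Δ) {τ : ℝ}
    (h : τ ∈ Set.Icc (π / 2) π) : retardedArg Δ τ ∈ Set.Icc (π / 2) τ := by
  rcases h.1.lt_or_eq with h2 | h2
  · rw [retardedArg_of_ne h2.ne']
    exact ⟨hΔ.right τ ⟨h2, h.2⟩, by linarith [hΔ.nonneg_right τ ⟨h2, h.2⟩]⟩
  · simp [retardedArg, ← h2]

theorem IsRetardation.retardedArg_mem {Δ : ℝ → ℝ} (hΔ : IsRetardation Δ) {τ : ℝ}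
    (h : τ ∈ Set.Icc 0 π) : retardedArg Δ τ ∈ Set.Icc 0 τ := by
  rcases le_total τ (π / 2) with h2 | h2
  · exact hΔ.retardedArg_mem_left ⟨h.1, h2⟩
  · have := hΔ.retardedArg_mem_right ⟨h2, h.2⟩
    exact ⟨le_trans (by positivity) this.1, this.2⟩

/-- The retarded term `q(τ) u(τ - Δ(τ))`. -/
noncomputable def retardedTerm (q Δ : ℝ → ℝ) (u : ℝ → ℂ) (τ : ℝ) : ℂ :=
  (q τ : ℂ) * u (retardedArg Δ τ)

section

variable {q Δ : ℝ → ℝ}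

/-- On `[0, π / 2)` the retarded term agrees with a continuous function on the line. -/
theorem exists_continuous_retardedTerm_left (hq : IsPiecewiseContinuous q) (hΔ : IsRetardation Δ)
    {u : ℝ → ℂ} (hu : Continuous u) :
    ∃ g : ℝ → ℂ, Continuous g ∧ Set.EqOn (retardedTerm q Δ u) g (Set.Ico 0 (π / 2)) := by
  obtain ⟨k, hk, hqk⟩ := hq.exists_continuous_left
  obtain ⟨d, hd, hΔd⟩ := hΔ.piecewise.exists_continuous_left
  refine ⟨fun τ => (k τ : ℂ) * u (τ - d τ), by fun_prop, fun τ hτ => ?_⟩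
  simp only [retardedTerm, retardedArg_of_ne hτ.2.ne, hqk hτ, hΔd hτ]

theorem exists_continuous_retardedTerm_right (hq : IsPiecewiseContinuous q) (hΔ : IsRetardation Δ)
    {u : ℝ → ℂ} (hu : Continuous u) :
    ∃ g : ℝ → ℂ, Continuous g ∧ Set.EqOn (retardedTerm q Δ u) g (Set.Ioc (π / 2) π) := by
  obtain ⟨k, hk, hqk⟩ := hq.exists_continuous_right
  obtain ⟨d, hd, hΔd⟩ := hΔ.piecewise.exists_continuous_right
  refine ⟨fun τ => (k τ : ℂ) * u (τ - d τ), by fun_prop, fun τ hτ => ?_⟩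
  simp only [retardedTerm, retardedArg_of_ne hτ.1.ne', hqk hτ, hΔd hτ]

theorem intervalIntegrable_retardedTerm (hq : IsPiecewiseContinuous q) (hΔ : IsRetardation Δ)
    {u : ℝ → ℂ} (hu : Continuous u) :
    IntervalIntegrable (retardedTerm q Δ u) MeasureTheory.volume 0 π := by
  obtain ⟨g, hg, hfg⟩ := exists_continuous_retardedTerm_left hq hΔ hu
  obtain ⟨k, hk, hfk⟩ := exists_continuous_retardedTerm_right hq hΔ hu
  exact intervalIntegrable_of_eqOn_continuous hg hk hfg hfk

theorem intervalIntegrable_retardedTerm_sub (hq : IsPiecewiseContinuous q)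
    (hΔ : IsRetardation Δ) {u : ℝ → ℂ} (hu : Continuous u) {x y : ℝ} (hx : x ∈ Set.Icc 0 π)
    (hy : y ∈ Set.Icc 0 π) :
    IntervalIntegrable (retardedTerm q Δ u) MeasureTheory.volume x y :=
  (intervalIntegrable_retardedTerm hq hΔ hu).mono_set (by
    rw [Set.uIcc_of_le Real.pi_pos.le]; exact Set.uIcc_subset_Icc hx hy)

theorem retardedTerm_add (u v : ℝ → ℂ) (τ : ℝ) :
    retardedTerm q Δ (fun t => u t + v t) τ = retardedTerm q Δ u τ + retardedTerm q Δ v τ :=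
  mul_add _ _ _

theorem retardedTerm_const_mul (c : ℂ) (u : ℝ → ℂ) (τ : ℝ) :
    retardedTerm q Δ (fun t => c * u t) τ = c * retardedTerm q Δ u τ :=
  mul_left_comm _ _ _

theorem norm_retardedTerm_le (hΔ : IsRetardation Δ) {K : ℝ}
    (hK : ∀ x ∈ Set.Icc 0 π, |q x| ≤ K) {u : ℝ → ℂ} {g : ℝ → ℝ}
    (hg : MonotoneOn g (Set.Icc 0 π)) (hu : ∀ x ∈ Set.Icc 0 π, ‖u x‖ ≤ g x) {τ : ℝ}
    (hτ : τ ∈ Set.Icc 0 π) : ‖retardedTerm q Δ u τ‖ ≤ K * g τ := by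
  have h := hΔ.retardedArg_mem hτ
  have hm : retardedArg Δ τ ∈ Set.Icc 0 π := ⟨h.1, h.2.trans hτ.2⟩
  rw [retardedTerm, norm_mul, Complex.norm_real, Real.norm_eq_abs]
  have h1 := (hu _ hm).trans (hg hm hτ h.2)
  exact mul_le_mul (hK τ hτ) h1 (norm_nonneg _) ((abs_nonneg _).trans (hK τ hτ))

end

/-! ### The integral equation and its entire dependence on the parameter -/

/-- The extension of a continuous function on `[0, π]` to the line by its end values. -/
noncomputable abbrev extendIcc (y : C(Set.Icc (0 : ℝ) π, ℂ)) : ℝ → ℂ :=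
  Set.IccExtend Real.pi_nonneg y

theorem continuous_extendIcc (y : C(Set.Icc (0 : ℝ) π, ℂ)) : Continuous (extendIcc y) :=
  y.continuous.Icc_extend'

theorem extendIcc_apply (y : C(Set.Icc (0 : ℝ) π, ℂ)) (x : Set.Icc (0 : ℝ) π) :
    extendIcc y x = y x := Set.IccExtend_val _ _ x

theorem extendIcc_of_mem (y : C(Set.Icc (0 : ℝ) π, ℂ)) {x : ℝ} (hx : x ∈ Set.Icc 0 π) :
    extendIcc y x = y ⟨x, hx⟩ := Set.IccExtend_of_mem _ _ hx

theorem norm_extendIcc_le (y : C(Set.Icc (0 : ℝ) π, ℂ)) (x : ℝ) : ‖extendIcc y x‖ ≤ ‖y‖ :=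
  y.norm_coe_le_norm _

theorem continuousOn_integral_retardedTerm {q Δ : ℝ → ℝ} (hq : IsPiecewiseContinuous q)
    (hΔ : IsRetardation Δ) {u : ℝ → ℂ} (hu : Continuous u) :
    ContinuousOn (fun x => ∫ τ in (0 : ℝ)..x, retardedTerm q Δ u τ) (Set.Icc 0 π) := by
  have h := intervalIntegral.continuousOn_primitive_interval
    ((intervalIntegrable_iff' (by simp)).1 (intervalIntegrable_retardedTerm hq hΔ hu))
  rwa [Set.uIcc_of_le Real.pi_nonneg] at h

theorem continuous_integral_retardedTerm {q Δ : ℝ → ℝ} (hq : IsPiecewiseContinuous q)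
    (hΔ : IsRetardation Δ) {u : ℝ → ℂ} (hu : Continuous u) :
    Continuous fun x : Set.Icc 0 π => ∫ τ in (0 : ℝ)..x, retardedTerm q Δ u τ :=
  (continuousOn_integral_retardedTerm hq hΔ hu).domRestrict

/-- A pointwise bound by a monomial improves by one degree under the Volterra operator; iterating
this produces the factorials that make the Volterra operators quasinilpotent. -/
theorem norm_integral_retardedTerm_le {q Δ : ℝ → ℝ} (hΔ : IsRetardation Δ) {K : ℝ}
    (hK : ∀ x ∈ Set.Icc 0 π, |q x| ≤ K) {u : ℝ → ℂ} {c : ℝ} (hc : 0 ≤ c) {n : ℕ}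
    (hu : ∀ x ∈ Set.Icc 0 π, ‖u x‖ ≤ c * x ^ n) {x : ℝ} (hx : x ∈ Set.Icc 0 π) :
    ‖∫ τ in (0 : ℝ)..x, retardedTerm q Δ u τ‖ ≤ K * c * (x ^ (n + 1) / (n + 1)) := by
  have hm : MonotoneOn (fun x : ℝ => c * x ^ n) (Set.Icc 0 π) := fun a ha d _ had =>
    mul_le_mul_of_nonneg_left (pow_le_pow_left₀ ha.1 had n) hc
  refine (intervalIntegral.norm_integral_le_of_norm_le (g := fun τ => K * (c * τ ^ n)) hx.1
    (Filter.Eventually.of_forall fun τ hτ =>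
      norm_retardedTerm_le hΔ hK hm hu ⟨hτ.1.le, hτ.2.trans hx.2⟩)
    ((by fun_prop : Continuous fun τ : ℝ => K * (c * τ ^ n)).intervalIntegrable _ _)).trans_eq ?_
  simp only [intervalIntegral.integral_const_mul, integral_pow]
  ring_nf

/-- The Volterra operator `y ↦ ∫₀ˣ q(τ) y(τ - Δ(τ)) dτ` on continuous functions on `[0, π]`. -/
noncomputable def volterra (q Δ : ℝ → ℝ) (hq : IsPiecewiseContinuous q) (hΔ : IsRetardation Δ) :
    C(Set.Icc (0 : ℝ) π, ℂ) →L[ℂ] C(Set.Icc (0 : ℝ) π, ℂ) :=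
  LinearMap.mkContinuousOfExistsBound
    { toFun := fun y => ⟨fun x => ∫ τ in (0 : ℝ)..x, retardedTerm q Δ (extendIcc y) τ,
        continuous_integral_retardedTerm hq hΔ (continuous_extendIcc y)⟩
      map_add' := fun y z => by
        ext x
        have h0 : (0 : ℝ) ∈ Set.Icc 0 π := ⟨le_rfl, Real.pi_nonneg⟩
        rw [ContinuousMap.add_apply]
        simp only [ContinuousMap.coe_mk]
        rw [← intervalIntegral.integral_add
          (intervalIntegrable_retardedTerm_sub hq hΔ (continuous_extendIcc y) h0 x.2)
          (intervalIntegrable_retardedTerm_sub hq hΔ (continuous_extendIcc z) h0 x.2)]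
        refine intervalIntegral.integral_congr fun τ _ => ?_
        exact retardedTerm_add _ _ τ
      map_smul' := fun c y => by
        ext x
        rw [ContinuousMap.smul_apply]
        simp only [ContinuousMap.coe_mk, RingHom.id_apply, smul_eq_mul]
        rw [← intervalIntegral.integral_const_mul]
        refine intervalIntegral.integral_congr fun τ _ => ?_
        exact retardedTerm_const_mul c _ τ }
    (by
      obtain ⟨K, hK0, hK⟩ := hq.exists_bound
      refine ⟨K * π, fun y => ?_⟩
      rw [ContinuousMap.norm_le _ (by positivity)]
      intro x
      refine (norm_integral_retardedTerm_le hΔ hK (norm_nonneg y) (n := 0)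
        (fun t _ => by simpa using norm_extendIcc_le y t) x.2).trans ?_
      have := x.2.2
      have h2 : K * ‖y‖ * (x : ℝ) ≤ K * ‖y‖ * π := by gcongr
      norm_num
      linarith)

theorem volterra_apply {q Δ : ℝ → ℝ} (hq : IsPiecewiseContinuous q) (hΔ : IsRetardation Δ)
    (y : C(Set.Icc (0 : ℝ) π, ℂ)) (x : Set.Icc (0 : ℝ) π) :
    volterra q Δ hq hΔ y x = ∫ τ in (0 : ℝ)..x, retardedTerm q Δ (extendIcc y) τ := rfl

theorem isPiecewiseContinuous_const (c : ℝ) : IsPiecewiseContinuous fun _ => c :=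
  ⟨continuousOn_const, continuousOn_const, ⟨c, tendsto_const_nhds⟩, ⟨c, tendsto_const_nhds⟩⟩

theorem isRetardation_zero : IsRetardation fun _ => 0 where
  piecewise := isPiecewiseContinuous_const 0
  nonneg_left _ _ := le_rfl
  nonneg_right _ _ := le_rfl
  left x hx := by simpa using hx.1
  right x hx := by simpa using hx.1.le

theorem retardedTerm_one_zero (u : ℝ → ℂ) (τ : ℝ) :
    retardedTerm (fun _ => 1) (fun _ => 0) u τ = u τ := by
  have : retardedArg (fun _ => 0) τ = τ := by unfold retardedArg; split_ifs <;> simp [*]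
  simp [retardedTerm, this]

/-- Pairs `(u, v)` of continuous functions on `[0, π]`, the space of the first order system. -/
abbrev PairSpace := C(Set.Icc (0 : ℝ) π, ℂ) × C(Set.Icc (0 : ℝ) π, ℂ)

/-- The operator `(u, v) ↦ (∫ v, -∫ (μ² u + q u(· - Δ)))`: the first order system of the
differential equation is `(u, v) = (u(0), v(0)) + T (u, v)`. -/
noncomputable def systemOp (q Δ : ℝ → ℝ) (hq : IsPiecewiseContinuous q) (hΔ : IsRetardation Δ)
    (μ : ℂ) : PairSpace →L[ℂ]
      PairSpace :=
  let J := volterra _ _ (isPiecewiseContinuous_const 1) isRetardation_zero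
  let p₁ := ContinuousLinearMap.fst ℂ C(Set.Icc (0 : ℝ) π, ℂ) C(Set.Icc (0 : ℝ) π, ℂ)
  let p₂ := ContinuousLinearMap.snd ℂ C(Set.Icc (0 : ℝ) π, ℂ) C(Set.Icc (0 : ℝ) π, ℂ)
  ((J.comp p₂).prod (-((volterra q Δ hq hΔ).comp p₁))) +
    μ ^ 2 • ((0 : _ →L[ℂ] _).prod (-(J.comp p₁)))

section

variable {q Δ : ℝ → ℝ} (hq : IsPiecewiseContinuous q) (hΔ : IsRetardation Δ)

theorem systemOp_fst (μ : ℂ) (Y : PairSpace)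
    (x : Set.Icc (0 : ℝ) π) :
    (systemOp q Δ hq hΔ μ Y).1 x = ∫ τ in (0 : ℝ)..x, extendIcc Y.2 τ := by
  simp [systemOp, volterra_apply, retardedTerm_one_zero]

theorem systemOp_snd (μ : ℂ) (Y : PairSpace)
    (x : Set.Icc (0 : ℝ) π) :
    (systemOp q Δ hq hΔ μ Y).2 x = -(μ ^ 2 * ∫ τ in (0 : ℝ)..x, extendIcc Y.1 τ) -
      ∫ τ in (0 : ℝ)..x, retardedTerm q Δ (extendIcc Y.1) τ := by
  simp [systemOp, volterra_apply, retardedTerm_one_zero]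
  ring

theorem norm_systemOp_pow_le {K : ℝ} (hK0 : 0 ≤ K) (hK : ∀ x ∈ Set.Icc 0 π, |q x| ≤ K) (μ : ℂ)
    (Y : PairSpace) (n : ℕ) (x : Set.Icc (0 : ℝ) π) :
    ‖((systemOp q Δ hq hΔ μ ^ n) Y).1 x‖ ≤
        (1 + ‖μ‖ ^ 2 + K) ^ n * ‖Y‖ / n.factorial * (x : ℝ) ^ n ∧
      ‖((systemOp q Δ hq hΔ μ ^ n) Y).2 x‖ ≤
        (1 + ‖μ‖ ^ 2 + K) ^ n * ‖Y‖ / n.factorial * (x : ℝ) ^ n := by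
  induction n generalizing x with
  | zero =>
    simpa using ⟨(Y.1.norm_coe_le_norm x).trans (norm_fst_le Y),
      (Y.2.norm_coe_le_norm x).trans (norm_snd_le Y)⟩
  | succ n ih =>
    set Z := (systemOp q Δ hq hΔ μ ^ n) Y with hZ
    have hs : (systemOp q Δ hq hΔ μ ^ (n + 1)) Y = systemOp q Δ hq hΔ μ Z := by
      rw [pow_succ']; rfl
    set L := 1 + ‖μ‖ ^ 2 + K with hL
    set c := L ^ n * ‖Y‖ / n.factorial with hc
    have hc0 : 0 ≤ c := by positivity
    have h1 : ∀ t ∈ Set.Icc 0 π, ‖extendIcc Z.1 t‖ ≤ c * t ^ n := fun t ht => by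
      rw [← Subtype.coe_mk t ht, extendIcc_apply]; exact (ih _).1
    have h2 : ∀ t ∈ Set.Icc 0 π, ‖extendIcc Z.2 t‖ ≤ c * t ^ n := fun t ht => by
      rw [← Subtype.coe_mk t ht, extendIcc_apply]; exact (ih _).2
    have hone : ∀ x ∈ Set.Icc 0 π, |(fun _ : ℝ => (1 : ℝ)) x| ≤ 1 := by simp
    have e1 := norm_integral_retardedTerm_le isRetardation_zero hone hc0 h1 x.2
    have e2 := norm_integral_retardedTerm_le isRetardation_zero hone hc0 h2 x.2
    have e3 := norm_integral_retardedTerm_le hΔ hK hc0 h1 x.2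
    simp only [retardedTerm_one_zero] at e1 e2
    have hx0 : (0 : ℝ) ≤ x := x.2.1
    set m := c * ((x : ℝ) ^ (n + 1) / (n + 1)) with hm
    have hm0 : 0 ≤ m := by positivity
    have hgoal : L ^ (n + 1) * ‖Y‖ / (n + 1).factorial * (x : ℝ) ^ (n + 1) = L * m := by
      rw [hm, hc, Nat.factorial_succ]; push_cast; field_simp; ring
    rw [hs, hgoal, systemOp_fst, systemOp_snd]
    constructor
    · refine e2.trans ?_
      have : (1 : ℝ) * m ≤ L * m := by
        gcongr; rw [hL]; nlinarith [sq_nonneg ‖μ‖]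
      linarith
    · refine (norm_sub_le _ _).trans ?_
      rw [norm_neg, norm_mul, norm_pow]
      have : ‖μ‖ ^ 2 * ‖∫ τ in (0 : ℝ)..x, extendIcc Z.1 τ‖ ≤ ‖μ‖ ^ 2 * m := by
        gcongr; linarith
      have h4 : L * m = m + ‖μ‖ ^ 2 * m + K * m := by rw [hL]; ring
      linarith

theorem isUnit_one_sub_of_norm_pow_lt_one {R : Type*} [NormedRing R] [HasSummableGeomSeries R]
    {x : R} {n : ℕ} (h : ‖x ^ n‖ < 1) : IsUnit (1 - x) := by
  have hu : IsUnit (1 - x ^ n) := isUnit_one_sub_of_norm_lt_one h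
  rw [← mul_neg_geom_sum] at hu
  have hcomm : Commute (1 - x) (∑ i ∈ Finset.range n, x ^ i) := by
    rw [Commute, SemiconjBy, mul_neg_geom_sum, geom_sum_mul_neg]
  exact (hcomm.isUnit_mul_iff.1 hu).1

theorem isUnit_one_sub_systemOp (μ : ℂ) : IsUnit (1 - systemOp q Δ hq hΔ μ) := by
  obtain ⟨K, hK0, hK⟩ := hq.exists_bound
  set T := systemOp q Δ hq hΔ μ
  set L := 1 + ‖μ‖ ^ 2 + K
  obtain ⟨n, hn⟩ := ((FloorSemiring.tendsto_pow_div_factorial_atTop (L * π)).eventually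
    (gt_mem_nhds (zero_lt_one' ℝ))).exists
  have hT : ‖T ^ n‖ < 1 := by
    refine lt_of_le_of_lt (ContinuousLinearMap.opNorm_le_bound _ (by positivity) fun Y => ?_) hn
    have hb : ∀ x : Set.Icc (0 : ℝ) π, L ^ n * ‖Y‖ / n.factorial * (x : ℝ) ^ n ≤
        (L * π) ^ n / n.factorial * ‖Y‖ := fun x => by
      have : (x : ℝ) ^ n ≤ π ^ n := pow_le_pow_left₀ x.2.1 x.2.2 n
      calc _ ≤ L ^ n * ‖Y‖ / n.factorial * π ^ n := by gcongr
        _ = _ := by rw [mul_pow]; ring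
    rw [Prod.norm_def, max_le_iff]
    have h := norm_systemOp_pow_le hq hΔ hK0.le hK μ Y n
    exact ⟨(ContinuousMap.norm_le _ (by positivity)).2 fun x => (h x).1.trans (hb x),
      (ContinuousMap.norm_le _ (by positivity)).2 fun x => (h x).2.trans (hb x)⟩
  exact isUnit_one_sub_of_norm_pow_lt_one (R := PairSpace →L[ℂ] PairSpace) hT

/-- The solution `(u, v)` of the first order system with the initial values `A`, `B`. -/
noncomputable def systemSolution (μ A B : ℂ) :
    PairSpace :=
  Ring.inverse (1 - systemOp q Δ hq hΔ μ) (ContinuousMap.const _ A, ContinuousMap.const _ B)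

theorem eq_systemSolution_iff (μ A B : ℂ)
    (Y : PairSpace) :
    Y = systemSolution hq hΔ μ A B ↔
      Y = (ContinuousMap.const _ A, ContinuousMap.const _ B) + systemOp q Δ hq hΔ μ Y := by
  have hu := isUnit_one_sub_systemOp hq hΔ μ
  have h1 := Ring.inverse_mul_cancel _ hu
  have h2 := Ring.mul_inverse_cancel _ hu
  rw [← sub_eq_iff_eq_add]
  constructor
  · rintro rfl
    exact congrArg (fun S => S (ContinuousMap.const _ A, ContinuousMap.const _ B)) h2
  · intro h
    rw [systemSolution, ← h]
    exact (congrArg (fun S => S Y) h1).symm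

theorem differentiable_inverse_one_sub_apply {E : Type*} [NormedAddCommGroup E]
    [NormedSpace ℂ E] [CompleteSpace E] {T : ℂ → E →L[ℂ] E} {S S' : E →L[ℂ] E}
    (hT : ∀ μ, T μ = S + μ ^ 2 • S') (hu : ∀ μ, IsUnit (1 - T μ)) {c : ℂ → E}
    (hc : Differentiable ℂ c) : Differentiable ℂ fun μ => Ring.inverse (1 - T μ) (c μ) := by
  have hop : Differentiable ℂ fun μ => 1 - T μ := by
    simp_rw [hT]
    fun_prop
  have hinv : Differentiable ℂ fun μ => Ring.inverse (1 - T μ) := fun μ =>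
    DifferentiableAt.comp (f := fun μ => 1 - T μ) μ (differentiableAt_inverse (hu μ)) (hop μ)
  exact hinv.clm_apply hc

theorem differentiable_systemSolution {A B : ℂ → ℂ} (hA : Differentiable ℂ A)
    (hB : Differentiable ℂ B) :
    Differentiable ℂ fun μ => systemSolution hq hΔ μ (A μ) (B μ) := by
  have hc : ∀ {f : ℂ → ℂ}, Differentiable ℂ f →
      Differentiable ℂ fun μ => ContinuousMap.const (Set.Icc (0 : ℝ) π) (f μ) := fun {f} hf => by
    have : ∀ μ, ContinuousMap.const (Set.Icc (0 : ℝ) π) (f μ) =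
        f μ • (1 : C(Set.Icc (0 : ℝ) π, ℂ)) := fun μ => by ext; simp
    simp_rw [this]
    exact hf.smul_const _
  exact differentiable_inverse_one_sub_apply (E := PairSpace) (fun _ => rfl)
    (isUnit_one_sub_systemOp hq hΔ) ((hc hA).prodMk (hc hB))

end

/-! ### Solutions with an interface as solutions on the whole interval -/

/-- `(u, v)` solves the first order system of the differential equation on `[0, π]`, in integrated
form; `u` and `v` are continuous on the line, their values outside `[0, π]` being irrelevant. -/
structure IsSystemSolution (q Δ : ℝ → ℝ) (μ : ℂ) (u v : ℝ → ℂ) : Prop where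
  continuous_fst : Continuous u
  continuous_snd : Continuous v
  fst_eq : ∀ x ∈ Set.Icc 0 π, u x = u 0 + ∫ τ in (0 : ℝ)..x, v τ
  snd_eq : ∀ x ∈ Set.Icc 0 π, v x = v 0 - μ ^ 2 * (∫ τ in (0 : ℝ)..x, u τ) -
    ∫ τ in (0 : ℝ)..x, retardedTerm q Δ u τ

section

variable {q Δ : ℝ → ℝ} (hq : IsPiecewiseContinuous q) (hΔ : IsRetardation Δ)

theorem isSystemSolution_systemSolution (μ A B : ℂ) :
    IsSystemSolution q Δ μ (extendIcc (systemSolution hq hΔ μ A B).1)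
        (extendIcc (systemSolution hq hΔ μ A B).2) ∧
      extendIcc (systemSolution hq hΔ μ A B).1 0 = A ∧
      extendIcc (systemSolution hq hΔ μ A B).2 0 = B := by
  set Y := systemSolution hq hΔ μ A B with hY
  have h := (eq_systemSolution_iff hq hΔ μ A B Y).1 hY
  have h1 : ∀ x ∈ Set.Icc 0 π, extendIcc Y.1 x = A + ∫ τ in (0 : ℝ)..x, extendIcc Y.2 τ :=
    fun x hx => by
      rw [extendIcc_of_mem _ hx, ← systemOp_fst hq hΔ μ Y ⟨x, hx⟩]
      exact congrArg (fun Z : PairSpace => Z.1 ⟨x, hx⟩) h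
  have h2 : ∀ x ∈ Set.Icc 0 π, extendIcc Y.2 x = B - μ ^ 2 *
      (∫ τ in (0 : ℝ)..x, extendIcc Y.1 τ) -
        ∫ τ in (0 : ℝ)..x, retardedTerm q Δ (extendIcc Y.1) τ := fun x hx => by
    have := systemOp_snd hq hΔ μ Y ⟨x, hx⟩
    have h' : Y.2 ⟨x, hx⟩ = B + (systemOp q Δ hq hΔ μ Y).2 ⟨x, hx⟩ :=
      congrArg (fun Z : PairSpace => Z.2 ⟨x, hx⟩) h
    rw [extendIcc_of_mem _ hx, h', this]
    ring
  have h0 : (0 : ℝ) ∈ Set.Icc 0 π := ⟨le_rfl, Real.pi_nonneg⟩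
  have hA : extendIcc Y.1 0 = A := by rw [h1 0 h0]; simp
  have hB : extendIcc Y.2 0 = B := by rw [h2 0 h0]; simp
  exact ⟨⟨continuous_extendIcc _, continuous_extendIcc _, by rwa [hA], by rwa [hB]⟩, hA, hB⟩

theorem IsSystemSolution.eq_systemSolution {μ : ℂ} {u v : ℝ → ℂ}
    (h : IsSystemSolution q Δ μ u v) {x : ℝ} (hx : x ∈ Set.Icc 0 π) :
    u x = extendIcc (systemSolution hq hΔ μ (u 0) (v 0)).1 x ∧
      v x = extendIcc (systemSolution hq hΔ μ (u 0) (v 0)).2 x := by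
  set Y : PairSpace := (⟨_, h.continuous_fst.comp continuous_subtype_val⟩,
    ⟨_, h.continuous_snd.comp continuous_subtype_val⟩) with hY
  have e1 : ∀ x ∈ Set.Icc 0 π, extendIcc Y.1 x = u x := fun x hx => extendIcc_of_mem _ hx
  have e2 : ∀ x ∈ Set.Icc 0 π, extendIcc Y.2 x = v x := fun x hx => extendIcc_of_mem _ hx
  have hsub : ∀ x : Set.Icc (0 : ℝ) π, ∀ τ ∈ Set.uIcc 0 (x : ℝ), τ ∈ Set.Icc 0 π := fun x τ hτ => by
    rw [Set.uIcc_of_le x.2.1] at hτ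
    exact ⟨hτ.1, hτ.2.trans x.2.2⟩
  have hYs : Y = systemSolution hq hΔ μ (u 0) (v 0) := by
    rw [eq_systemSolution_iff]
    ext x
    · change u x = u 0 + (systemOp q Δ hq hΔ μ Y).1 x
      rw [systemOp_fst, h.fst_eq x x.2,
        intervalIntegral.integral_congr fun τ hτ => e2 τ (hsub x τ hτ)]
    · change v x = v 0 + (systemOp q Δ hq hΔ μ Y).2 x
      rw [systemOp_snd, h.snd_eq x x.2,
        intervalIntegral.integral_congr fun τ hτ => e1 τ (hsub x τ hτ),
        intervalIntegral.integral_congr (f := retardedTerm q Δ (extendIcc Y.1))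
          (g := retardedTerm q Δ u)]
      · ring
      · intro τ hτ
        have hm := hΔ.retardedArg_mem (hsub x τ hτ)
        simp only [retardedTerm]
        rw [e1 _ ⟨hm.1, hm.2.trans (hsub x τ hτ).2⟩]
  rw [← hYs]
  exact ⟨(e1 x hx).symm, (e2 x hx).symm⟩

end

section

variable {q Δ : ℝ → ℝ}

theorem IsSystemSolution.hasDerivWithinAt_fst {μ : ℂ} {u v : ℝ → ℂ}
    (h : IsSystemSolution q Δ μ u v) {x : ℝ} (hx : x ∈ Set.Icc 0 π) :
    HasDerivWithinAt u (v x) (Set.Icc 0 π) x :=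
  ((h.continuous_snd.integral_hasStrictDerivAt 0 x).hasDerivAt.const_add
    (u 0)).hasDerivWithinAt.congr h.fst_eq (h.fst_eq x hx)

theorem hasDerivWithinAt_of_eq_integral {s : Set ℝ} {u v g : ℝ → ℂ} {μ c : ℂ} {a x : ℝ}
    (hu : Continuous u) (hg : Continuous g)
    (hv : ∀ t ∈ s, v t = c - μ ^ 2 * (∫ τ in (0 : ℝ)..t, u τ) - ∫ τ in a..t, g τ) (hx : x ∈ s) :
    HasDerivWithinAt v (-μ ^ 2 * u x - g x) s x := by
  have h := (((hu.integral_hasStrictDerivAt 0 x).hasDerivAt.const_mul (μ ^ 2)).const_sub c).sub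
    (hg.integral_hasStrictDerivAt a x).hasDerivAt
  rw [neg_mul]
  exact h.hasDerivWithinAt.congr hv (hv x hx)

theorem IsSystemSolution.hasDerivWithinAt_snd_left (hq : IsPiecewiseContinuous q)
    (hΔ : IsRetardation Δ) {μ : ℂ} {u v : ℝ → ℂ}
    (h : IsSystemSolution q Δ μ u v) {x : ℝ} (hx : x ∈ Set.Ico 0 (π / 2)) :
    HasDerivWithinAt v (-μ ^ 2 * u x - retardedTerm q Δ u x) (Set.Ico 0 (π / 2)) x := by
  obtain ⟨g, hg, hfg⟩ := exists_continuous_retardedTerm_left hq hΔ h.continuous_fst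
  rw [hfg hx]
  refine hasDerivWithinAt_of_eq_integral (c := v 0) (a := 0) h.continuous_fst hg
    (fun t ht => ?_) hx
  rw [h.snd_eq t ⟨ht.1, by linarith [ht.2, Real.pi_pos]⟩]
  congr 1
  refine intervalIntegral.integral_congr fun τ hτ => ?_
  rw [Set.uIcc_of_le ht.1] at hτ
  exact hfg ⟨hτ.1, hτ.2.trans_lt ht.2⟩

theorem IsSystemSolution.hasDerivWithinAt_snd_right (hq : IsPiecewiseContinuous q)
    (hΔ : IsRetardation Δ) {μ : ℂ} {u v : ℝ → ℂ}
    (h : IsSystemSolution q Δ μ u v) {x : ℝ} (hx : x ∈ Set.Ioc (π / 2) π) :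
    HasDerivWithinAt v (-μ ^ 2 * u x - retardedTerm q Δ u x) (Set.Ioc (π / 2) π) x := by
  obtain ⟨g, hg, hfg⟩ := exists_continuous_retardedTerm_right hq hΔ h.continuous_fst
  rw [hfg hx]
  have hpi := Real.pi_pos
  refine hasDerivWithinAt_of_eq_integral (a := π / 2)
    (c := v 0 - ∫ τ in (0 : ℝ)..(π / 2), retardedTerm q Δ u τ) h.continuous_fst hg
    (fun t ht => ?_) hx
  have hm : π / 2 ∈ Set.Icc 0 π := ⟨by linarith, by linarith⟩
  have ht' : t ∈ Set.Icc 0 π := ⟨by linarith [ht.1], ht.2⟩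
  rw [h.snd_eq t ht', ← intervalIntegral.integral_add_adjacent_intervals (b := π / 2)
    (intervalIntegrable_retardedTerm_sub hq hΔ h.continuous_fst ⟨le_rfl, hpi.le⟩ hm)
    (intervalIntegrable_retardedTerm_sub hq hΔ h.continuous_fst hm ht')]
  have : ∫ τ in (π / 2)..t, retardedTerm q Δ u τ = ∫ τ in (π / 2)..t, g τ := by
    refine intervalIntegral.integral_congr_ae (Filter.Eventually.of_forall fun τ hτ => ?_)
    rw [Set.uIoc_of_le ht.1.le] at hτ
    exact hfg ⟨hτ.1, hτ.2.trans ht.2⟩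
  rw [this]
  ring

/-- The function with an interface at `π / 2` obtained from a solution on `[0, π]` by dividing it
by `δ` beyond `π / 2`. -/
noncomputable def TwoPiece.ofSystem (u v : ℝ → ℂ) (δ : ℝ) : TwoPiece where
  left := u
  left' := v
  right x := u x / δ
  right' x := v x / δ

theorem IsSystemSolution.solvesEquation (hq : IsPiecewiseContinuous q)
    (hΔ : IsRetardation Δ) {μ : ℂ} {u v : ℝ → ℂ}
    (h : IsSystemSolution q Δ μ u v) (δ : ℝ) :
    (TwoPiece.ofSystem u v δ).SolvesEquation q Δ μ where
  deriv_left x hx := by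
    have hpi := Real.pi_pos
    exact (h.hasDerivWithinAt_fst ⟨hx.1, by linarith [hx.2]⟩).mono
      (Set.Icc_subset_Icc_right (by linarith))
  deriv_right x hx := by
    have hpi := Real.pi_pos
    exact ((h.hasDerivWithinAt_fst ⟨by linarith [hx.1], hx.2⟩).mono
      (Set.Icc_subset_Icc_left (by linarith))).div_const (δ : ℂ)
  continuousOn_left' := h.continuous_snd.continuousOn
  continuousOn_right' := (h.continuous_snd.div_const _).continuousOn
  equation_left x hx := by
    have := h.hasDerivWithinAt_snd_left hq hΔ hx
    rwa [retardedTerm, retardedArg_of_ne hx.2.ne] at this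
  equation_right x hx := by
    have := (h.hasDerivWithinAt_snd_right hq hΔ hx).div_const (δ : ℂ)
    rw [retardedTerm, retardedArg_of_ne hx.1.ne'] at this
    refine HasDerivWithinAt.congr_deriv this ?_
    change _ = -μ ^ 2 * (u x / δ) - (q x : ℂ) * (u (x - Δ x) / δ)
    ring

theorem TwoPiece.interface_ofSystem (u v : ℝ → ℂ) {δ : ℝ} (hδ : δ ≠ 0) :
    (TwoPiece.ofSystem u v δ).Interface δ := by
  have : (δ : ℂ) ≠ 0 := by exact_mod_cast hδ
  constructor <;> simp only [TwoPiece.ofSystem] <;> field_simp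

/-- Gluing of two functions on `[0, π / 2]` and `[π / 2, π]` that match at `π / 2`: the difference
`f + g - f (π / 2)` of the extensions by constants is continuous on the line. -/
theorem exists_continuous_glue {f g : ℝ → ℂ} (hf : ContinuousOn f (Set.Icc 0 (π / 2)))
    (hg : ContinuousOn g (Set.Icc (π / 2) π)) (hfg : f (π / 2) = g (π / 2)) :
    ∃ u : ℝ → ℂ, Continuous u ∧ Set.EqOn u f (Set.Icc 0 (π / 2)) ∧
      Set.EqOn u g (Set.Icc (π / 2) π) := by
  have h0 : (0 : ℝ) ≤ π / 2 := by positivity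
  have h1 : π / 2 ≤ π := by linarith [Real.pi_pos]
  refine ⟨fun x => Set.IccExtend h0 ((Set.Icc 0 (π / 2)).domRestrict f) x +
    Set.IccExtend h1 ((Set.Icc (π / 2) π).domRestrict g) x - f (π / 2),
    ((continuousOn_iff_continuous_domRestrict.1 hf).Icc_extend'.add
      (continuousOn_iff_continuous_domRestrict.1 hg).Icc_extend').sub continuous_const,
    fun x hx => ?_, fun x hx => ?_⟩
  · simp only [Set.IccExtend_of_mem _ _ hx, Set.IccExtend_of_le_left _ _ hx.2,
      Set.domRestrict_apply, hfg]
    ring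
  · simp only [Set.IccExtend_of_mem _ _ hx, Set.IccExtend_of_right_le _ _ hx.1,
      Set.domRestrict_apply]
    ring

theorem TwoPiece.SolvesEquation.exists_isSystemSolution (hq : IsPiecewiseContinuous q)
    (hΔ : IsRetardation Δ) {μ : ℂ} {y : TwoPiece}
    (hy : y.SolvesEquation q Δ μ) {δ : ℝ} (hδ : y.Interface δ) :
    ∃ u v : ℝ → ℂ, IsSystemSolution q Δ μ u v ∧
      Set.EqOn u y.left (Set.Icc 0 (π / 2)) ∧ Set.EqOn v y.left' (Set.Icc 0 (π / 2)) ∧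
      Set.EqOn u (fun x => δ * y.right x) (Set.Icc (π / 2) π) ∧
      Set.EqOn v (fun x => δ * y.right' x) (Set.Icc (π / 2) π) := by
  have hpi := Real.pi_pos
  obtain ⟨u, hu, hul, hur⟩ := exists_continuous_glue
    (fun x hx => (hy.deriv_left x hx).continuousWithinAt)
    (fun x hx => ((hy.deriv_right x hx).const_mul (δ : ℂ)).continuousWithinAt) hδ.1
  obtain ⟨v, hv, hvl, hvr⟩ := exists_continuous_glue hy.continuousOn_left'
    (continuousOn_const.mul hy.continuousOn_right') hδ.2
  have hdl : ∀ t ∈ Set.Ioo 0 (π / 2), HasDerivAt u (v t) t ∧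
      HasDerivAt v (-μ ^ 2 * u t - retardedTerm q Δ u t) t := fun t ht => by
    have hn : Set.Ico 0 (π / 2) ∈ 𝓝 t := Ico_mem_nhds ht.1 ht.2
    have hn' : Set.Icc 0 (π / 2) ∈ 𝓝 t := Icc_mem_nhds ht.1 ht.2
    have hm := hΔ.retardedArg_mem_left (Set.Ioo_subset_Icc_self ht)
    rw [retardedTerm, hul (Set.Ioo_subset_Icc_self ht), hul ⟨hm.1, hm.2.trans ht.2.le⟩,
      hvl (Set.Ioo_subset_Icc_self ht), retardedArg_of_ne ht.2.ne]
    exact ⟨((hy.deriv_left t (Set.Ioo_subset_Icc_self ht)).hasDerivAt hn').congr_of_eventuallyEq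
      (hul.eventuallyEq_of_mem hn'),
      ((hy.equation_left t ⟨ht.1.le, ht.2⟩).hasDerivAt hn).congr_of_eventuallyEq
      (hvl.eventuallyEq_of_mem hn')⟩
  have hdr : ∀ t ∈ Set.Ioo (π / 2) π, HasDerivAt u (v t) t ∧
      HasDerivAt v (-μ ^ 2 * u t - retardedTerm q Δ u t) t := fun t ht => by
    have hn : Set.Ioc (π / 2) π ∈ 𝓝 t := Ioc_mem_nhds ht.1 ht.2
    have hn' : Set.Icc (π / 2) π ∈ 𝓝 t := Icc_mem_nhds ht.1 ht.2
    have hm := hΔ.retardedArg_mem_right (Set.Ioo_subset_Icc_self ht)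
    rw [retardedTerm, hur (Set.Ioo_subset_Icc_self ht), hur ⟨hm.1, hm.2.trans ht.2.le⟩,
      hvr (Set.Ioo_subset_Icc_self ht), retardedArg_of_ne ht.1.ne']
    refine ⟨(((hy.deriv_right t (Set.Ioo_subset_Icc_self ht)).hasDerivAt hn').const_mul
      (δ : ℂ)).congr_of_eventuallyEq (hur.eventuallyEq_of_mem hn'), ?_⟩
    refine ((((hy.equation_right t ⟨ht.1, ht.2.le⟩).hasDerivAt hn).const_mul
      (δ : ℂ)).congr_of_eventuallyEq (hvr.eventuallyEq_of_mem hn')).congr_deriv ?_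
    ring
  have hd : ∀ x ∈ Set.Icc 0 π, ∀ t ∈ Set.Ioo (min 0 x) (max 0 x) \ {π / 2},
      HasDerivAt u (v t) t ∧ HasDerivAt v (-μ ^ 2 * u t - retardedTerm q Δ u t) t :=
    fun x hx t ht => by
      rw [min_eq_left hx.1, max_eq_right hx.1] at ht
      rcases lt_or_gt_of_ne ht.2 with h | h
      · exact hdl t ⟨ht.1.1, h⟩
      · exact hdr t ⟨h, ht.1.2.trans_le hx.2⟩
  refine ⟨u, v, ⟨hu, hv, fun x hx => ?_, fun x hx => ?_⟩, hul, hvl, hur, hvr⟩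
  · rw [MeasureTheory.integral_eq_of_hasDerivAt_off_countable u v (Set.countable_singleton (π / 2))
      hu.continuousOn (fun t ht => (hd x hx t ht).1) (hv.intervalIntegrable _ _)]
    ring
  · have hi := intervalIntegrable_retardedTerm_sub hq hΔ hu ⟨le_rfl, hpi.le⟩ hx
    have hi' : IntervalIntegrable (fun t => -μ ^ 2 * u t) MeasureTheory.volume 0 x :=
      (continuous_const.mul hu).intervalIntegrable _ _
    have := MeasureTheory.integral_eq_of_hasDerivAt_off_countable v
      (fun t => -μ ^ 2 * u t - retardedTerm q Δ u t) (Set.countable_singleton (π / 2))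
      hv.continuousOn (fun t ht => (hd x hx t ht).2) (hi'.sub hi)
    rw [intervalIntegral.integral_sub hi' hi, intervalIntegral.integral_const_mul] at this
    linear_combination -this

end

/-! ### The characteristic function -/

/-- The value `cos b · y(π) + μ sin b · y'(π)` for the solution `y` of the equation and of the
interface conditions with `y(0) = A`, `y'(0) = B`. -/
noncomputable def endValue {q Δ : ℝ → ℝ} (hq : IsPiecewiseContinuous q) (hΔ : IsRetardation Δ)
    (b δ : ℝ) (μ A B : ℂ) : ℂ :=
  ((Real.cos b : ℂ) * extendIcc (systemSolution hq hΔ μ A B).1 π +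
    μ * (Real.sin b : ℂ) * extendIcc (systemSolution hq hΔ μ A B).2 π) / δ

section

variable {q Δ : ℝ → ℝ} (hq : IsPiecewiseContinuous q) (hΔ : IsRetardation Δ) (b δ : ℝ)

theorem pi_mem_Icc : π ∈ Set.Icc 0 π := ⟨Real.pi_nonneg, le_rfl⟩

theorem endValue_add_mul (μ A B A' B' c d : ℂ) :
    endValue hq hΔ b δ μ (c * A + d * A') (c * B + d * B') =
      c * endValue hq hΔ b δ μ A B + d * endValue hq hΔ b δ μ A' B' := by
  have h : systemSolution hq hΔ μ (c * A + d * A') (c * B + d * B') =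
      c • systemSolution hq hΔ μ A B + d • systemSolution hq hΔ μ A' B' := by
    simp only [systemSolution, ← map_smul, ← map_add]
    congr 1
  simp only [endValue, h, extendIcc_of_mem _ pi_mem_Icc, Prod.fst_add, Prod.snd_add, Prod.smul_fst,
    Prod.smul_snd, ContinuousMap.add_apply, ContinuousMap.smul_apply, smul_eq_mul]
  ring

theorem endValue_eq_linear (μ A B : ℂ) :
    endValue hq hΔ b δ μ A B =
      A * endValue hq hΔ b δ μ 1 0 + B * endValue hq hΔ b δ μ 0 1 := by
  rw [← endValue_add_mul]; simp

theorem differentiable_endValue {A B : ℂ → ℂ} (hA : Differentiable ℂ A)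
    (hB : Differentiable ℂ B) :
    Differentiable ℂ fun μ => endValue hq hΔ b δ μ (A μ) (B μ) := by
  have h := differentiable_systemSolution hq hΔ hA hB
  let e : C(Set.Icc (0 : ℝ) π, ℂ) →L[ℂ] ℂ := ContinuousMap.evalCLM ℂ ⟨π, pi_mem_Icc⟩
  have hev : Differentiable ℂ fun y : C(Set.Icc (0 : ℝ) π, ℂ) => y ⟨π, pi_mem_Icc⟩ :=
    e.differentiable
  have h1 : Differentiable ℂ fun μ =>
      (systemSolution hq hΔ μ (A μ) (B μ)).1 ⟨π, pi_mem_Icc⟩ := hev.comp h.fst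
  have h2 : Differentiable ℂ fun μ =>
      (systemSolution hq hΔ μ (A μ) (B μ)).2 ⟨π, pi_mem_Icc⟩ := hev.comp h.snd
  simp only [endValue, extendIcc_of_mem _ pi_mem_Icc]
  fun_prop

variable {b δ}

theorem IsSystemSolution.endValue_eq {μ : ℂ} {u v : ℝ → ℂ} (h : IsSystemSolution q Δ μ u v) :
    endValue hq hΔ b δ μ (u 0) (v 0) =
      ((Real.cos b : ℂ) * u π + μ * (Real.sin b : ℂ) * v π) / δ := by
  rw [endValue, ← (h.eq_systemSolution hq hΔ pi_mem_Icc).1,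
    ← (h.eq_systemSolution hq hΔ pi_mem_Icc).2]

theorem TwoPiece.SolvesEquation.endForm_eq {μ : ℂ} {y : TwoPiece} (hy : y.SolvesEquation q Δ μ)
    (hi : y.Interface δ) (hδ : δ ≠ 0) :
    y.endForm b μ = endValue hq hΔ b δ μ (y.left 0) (y.left' 0) := by
  have hpi := Real.pi_pos
  have hδ' : (δ : ℂ) ≠ 0 := by exact_mod_cast hδ
  obtain ⟨u, v, h, hul, hvl, hur, hvr⟩ := hy.exists_isSystemSolution hq hΔ hi
  have h0 : (0 : ℝ) ∈ Set.Icc 0 (π / 2) := ⟨le_rfl, by linarith⟩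
  have h1 : π ∈ Set.Icc (π / 2) π := ⟨by linarith, le_rfl⟩
  rw [← hul h0, ← hvl h0, h.endValue_eq, hur h1, hvr h1, TwoPiece.endForm]
  field_simp

theorem TwoPiece.SolvesEquation.not_nontrivial {μ : ℂ} {y : TwoPiece}
    (hq : IsPiecewiseContinuous q) (hΔ : IsRetardation Δ)
    (hy : y.SolvesEquation q Δ μ) (hi : y.Interface δ) (hδ : δ ≠ 0) (h0 : y.left 0 = 0)
    (h0' : y.left' 0 = 0) : ¬ y.Nontrivial := by
  have hpi := Real.pi_pos
  have hδ' : (δ : ℂ) ≠ 0 := by exact_mod_cast hδ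
  obtain ⟨u, v, h, hul, hvl, hur, -⟩ := hy.exists_isSystemSolution hq hΔ hi
  have hm : (0 : ℝ) ∈ Set.Icc 0 (π / 2) := ⟨le_rfl, by linarith⟩
  have hu : ∀ x ∈ Set.Icc 0 π, u x = 0 := fun x hx => by
    have hs : systemSolution hq hΔ μ 0 0 = 0 := by
      simp only [systemSolution]
      exact map_zero _
    rw [(h.eq_systemSolution hq hΔ hx).1, hul hm, hvl hm, h0, h0', hs, extendIcc_of_mem _ hx]
    rfl
  rintro (⟨x, hx, hne⟩ | ⟨x, hx, hne⟩)
  · exact hne ((hul hx).symm.trans (hu x ⟨hx.1, by linarith [hx.2]⟩))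
  · have h1 : (δ : ℂ) * y.right x = 0 := (hur hx).symm.trans (hu x ⟨by linarith [hx.1], hx.2⟩)
    exact (mul_ne_zero hδ' hne) h1

/-- The derivative is determined by the values, so vanishing values force vanishing Cauchy data
at `0`. -/
theorem TwoPiece.SolvesEquation.nontrivial {μ : ℂ} {y : TwoPiece} (hy : y.SolvesEquation q Δ μ)
    (h0 : y.left 0 ≠ 0 ∨ y.left' 0 ≠ 0) : y.Nontrivial := by
  have hpi := Real.pi_pos
  have hm : (0 : ℝ) ∈ Set.Icc 0 (π / 2) := ⟨le_rfl, by linarith⟩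
  by_contra hn
  have hz : ∀ x ∈ Set.Icc 0 (π / 2), y.left x = 0 := fun x hx => by
    by_contra h
    exact hn (Or.inl ⟨x, hx, h⟩)
  rcases h0 with h0 | h0
  · exact h0 (hz 0 hm)
  · have h1 := (uniqueDiffOn_Icc (by linarith) 0 hm).eq_deriv _ (hy.deriv_left 0 hm)
      ((hasDerivWithinAt_const (0 : ℝ) (Set.Icc 0 (π / 2)) (0 : ℂ)).congr hz (hz 0 hm))
    exact h0 h1

variable (b) (a₁ a₁' a₂ a₂' : ℝ)

theorem isCharacteristicFunction_endValue (hδ : δ ≠ 0) :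
    IsCharacteristicFunction q Δ a₁ a₁' a₂ a₂' b δ
      fun μ => endValue hq hΔ b δ μ (μ * a₂' + a₂) (μ * a₁' + a₁) := by
  intro μ
  obtain ⟨h, hA, hB⟩ := isSystemSolution_systemSolution hq hΔ μ (μ * a₂' + a₂) (μ * a₁' + a₁)
  refine ⟨⟨_, h.solvesEquation hq hΔ δ, TwoPiece.interface_ofSystem _ _ hδ, hA, hB⟩, ?_⟩
  intro ω hω
  rw [hω.solves.endForm_eq hq hΔ hω.interface hδ, hω.value_zero, hω.deriv_zero]

theorem isEigenvalue_iff_endValue_eq_zero (hδ : δ ≠ 0) (μ : ℂ) :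
    IsEigenvalue q Δ a₁ a₁' a₂ a₂' b δ μ ↔
      endValue hq hΔ b δ μ (μ * a₂' + a₂) (μ * a₁' + a₁) = 0 := by
  set α : ℂ := μ * a₂' + a₂
  set β : ℂ := μ * a₁' + a₁
  constructor
  · rintro ⟨y, hn, hy, hi, hbc, hend⟩
    rw [hy.endForm_eq hq hΔ hi hδ] at hend
    have key : ∀ c, α = c * y.left 0 → β = c * y.left' 0 → endValue hq hΔ b δ μ α β = 0 :=
      fun c h1 h2 => by
        have := endValue_add_mul hq hΔ b δ μ (y.left 0) (y.left' 0) 0 0 c 0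
        rw [hend] at this
        simpa [h1, h2] using this
    by_cases h0 : y.left 0 = 0
    · have h0' : y.left' 0 ≠ 0 := fun h => hy.not_nontrivial hq hΔ hi hδ h0 h hn
      refine key (β / y.left' 0) ?_ (by field_simp)
      rw [h0] at hbc ⊢
      have : α * y.left' 0 = 0 := by linear_combination -hbc
      simpa [h0'] using this
    · refine key (α / y.left 0) (by field_simp) ?_
      field_simp
      linear_combination hbc
  · intro h
    -- If both coefficients of the condition at `0` vanish, that condition is void, and the
    -- condition at `π` alone leaves a nonzero choice of Cauchy data.
    obtain ⟨A, B, hAB, hbc, hend⟩ : ∃ A B : ℂ, (A ≠ 0 ∨ B ≠ 0) ∧ β * A - α * B = 0 ∧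
        endValue hq hΔ b δ μ A B = 0 := by
      by_cases h0 : α ≠ 0 ∨ β ≠ 0
      · exact ⟨α, β, h0, by ring, h⟩
      · push Not at h0
        by_cases h1 : endValue hq hΔ b δ μ 1 0 = 0
        · exact ⟨1, 0, Or.inl one_ne_zero, by simp [h0], h1⟩
        · refine ⟨endValue hq hΔ b δ μ 0 1, -endValue hq hΔ b δ μ 1 0,
            Or.inr (neg_ne_zero.2 h1), by simp [h0], ?_⟩
          rw [endValue_eq_linear]
          ring
    obtain ⟨hs, hA, hB⟩ := isSystemSolution_systemSolution hq hΔ μ A B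
    have hy := hs.solvesEquation hq hΔ δ
    have hi := TwoPiece.interface_ofSystem (extendIcc (systemSolution hq hΔ μ A B).1)
      (extendIcc (systemSolution hq hΔ μ A B).2) hδ
    have hl : (TwoPiece.ofSystem (extendIcc (systemSolution hq hΔ μ A B).1)
      (extendIcc (systemSolution hq hΔ μ A B).2) δ).left 0 = A := hA
    have hl' : (TwoPiece.ofSystem (extendIcc (systemSolution hq hΔ μ A B).1)
      (extendIcc (systemSolution hq hΔ μ A B).2) δ).left' 0 = B := hB
    refine ⟨_, hy.nontrivial (by rwa [hl, hl']), hy, hi, ?_, ?_⟩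
    · rw [hl, hl']; exact hbc
    · rw [hy.endForm_eq hq hΔ hi hδ, hl, hl', hend]

end

/-! ### Bounds for the complex sine and cosine -/

theorem norm_cos_le_exp (z : ℂ) : ‖Complex.cos z‖ ≤ Real.exp |z.im| := by
  rw [Complex.cos, norm_div, Complex.norm_ofNat, div_le_iff₀ two_pos]
  refine (norm_add_le _ _).trans ?_
  simp only [Complex.norm_exp]
  have h1 : Real.exp (z * Complex.I).re ≤ Real.exp |z.im| := by
    gcongr; simpa using neg_le_abs z.im
  have h2 : Real.exp (-z * Complex.I).re ≤ Real.exp |z.im| := by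
    gcongr; simpa using le_abs_self z.im
  linarith

theorem norm_sin_le_exp (z : ℂ) : ‖Complex.sin z‖ ≤ Real.exp |z.im| := by
  rw [Complex.sin, norm_div, Complex.norm_ofNat, div_le_iff₀ two_pos, norm_mul, Complex.norm_I,
    mul_one]
  refine (norm_sub_le _ _).trans ?_
  simp only [Complex.norm_exp]
  have h1 : Real.exp (z * Complex.I).re ≤ Real.exp |z.im| := by
    gcongr; simpa using neg_le_abs z.im
  have h2 : Real.exp (-z * Complex.I).re ≤ Real.exp |z.im| := by
    gcongr; simpa using le_abs_self z.im
  linarith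

theorem norm_cos_mul_ofReal_le (μ : ℂ) {t : ℝ} (ht : 0 ≤ t) :
    ‖Complex.cos (μ * t)‖ ≤ Real.exp (|μ.im| * t) := by
  have := norm_cos_le_exp (μ * t)
  rwa [Complex.im_mul_ofReal, abs_mul, abs_of_nonneg ht] at this

theorem norm_sin_mul_ofReal_le (μ : ℂ) {t : ℝ} (ht : 0 ≤ t) :
    ‖Complex.sin (μ * t)‖ ≤ Real.exp (|μ.im| * t) := by
  have := norm_sin_le_exp (μ * t)
  rwa [Complex.im_mul_ofReal, abs_mul, abs_of_nonneg ht] at this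

theorem norm_sin_sq (z : ℂ) :
    ‖Complex.sin z‖ ^ 2 = Real.sin z.re ^ 2 + Real.sinh z.im ^ 2 := by
  have h : Complex.sin z = ((Real.sin z.re * Real.cosh z.im : ℝ) : ℂ) +
      ((Real.cos z.re * Real.sinh z.im : ℝ) : ℂ) * Complex.I := by
    conv_lhs => rw [← Complex.re_add_im z, Complex.sin_add_mul_I]
    push_cast; ring
  rw [← Complex.normSq_eq_norm_sq, h, Complex.normSq_add_mul_I]
  have h1 := Real.cosh_sq z.im
  have h2 := Real.sin_sq_add_cos_sq z.re
  rw [mul_pow, mul_pow, h1]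
  linear_combination Real.sinh z.im ^ 2 * h2

theorem abs_le_abs_sinh (y : ℝ) : |y| ≤ |Real.sinh y| := by
  rw [Real.abs_sinh]
  exact Real.self_le_sinh_iff.2 (abs_nonneg y)

/-- Jordan's inequality in the complex domain. -/
theorem two_mul_norm_le_norm_sin_pi_mul {w : ℂ} (hw : |w.re| ≤ 1 / 2) :
    2 * ‖w‖ ≤ ‖Complex.sin (π * w)‖ := by
  have hpi := Real.pi_gt_three
  refine (pow_le_pow_iff_left₀ (by positivity) (norm_nonneg _) two_ne_zero).1 ?_
  rw [norm_sin_sq, mul_pow, Complex.sq_norm, Complex.normSq_apply, Complex.re_ofReal_mul,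
    Complex.im_ofReal_mul]
  have h1 : 2 * |w.re| ≤ |Real.sin (π * w.re)| := by
    have hle : π * |w.re| ≤ π / 2 := by nlinarith
    have := Real.mul_le_sin (x := π * |w.re|) (by positivity) hle
    have h3 : 2 / π * (π * |w.re|) = 2 * |w.re| := by field_simp
    rw [h3] at this
    refine this.trans ?_
    rcases abs_cases w.re with h | h <;> rw [h.1]
    · exact le_abs_self _
    · rw [mul_neg, Real.sin_neg]; exact neg_le_abs _
  have h2 : 2 * |w.im| ≤ |Real.sinh (π * w.im)| := by
    refine le_trans ?_ (abs_le_abs_sinh _)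
    rw [abs_mul, abs_of_pos Real.pi_pos]
    nlinarith [abs_nonneg w.im]
  have h3 := pow_le_pow_left₀ (by positivity) h1 2
  have h4 := pow_le_pow_left₀ (by positivity) h2 2
  rw [mul_pow, sq_abs, sq_abs] at h3 h4
  linarith

theorem norm_sin_mul_pi_sub_intCast (z : ℂ) (n : ℤ) :
    ‖Complex.sin (π * (z - n))‖ = ‖Complex.sin (π * z)‖ := by
  have h : (π : ℂ) * (z - n) = π * z - n * π := by ring
  have hc : ‖Complex.cos (n * π)‖ = 1 := by
    have h1 := Complex.sin_sq_add_cos_sq (n * π)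
    rw [Complex.sin_int_mul_pi, zero_pow two_ne_zero, zero_add] at h1
    have h2 := congrArg norm h1
    rwa [norm_pow, norm_one, pow_eq_one_iff_of_nonneg (norm_nonneg _) two_ne_zero] at h2
  rw [h, Complex.sin_sub, Complex.sin_int_mul_pi, mul_zero, sub_zero, norm_mul, hc, mul_one]

/-- Away from the integers `sin πz` is as large as its trivial upper bound, up to a constant. -/
theorem exp_le_four_mul_norm_sin {z : ℂ} (hz : ∀ n : ℤ, 1 / 4 ≤ ‖z - n‖) :
    Real.exp (|z.im| * π) ≤ 4 * ‖Complex.sin (π * z)‖ := by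
  have h1 : 1 / 2 ≤ ‖Complex.sin (π * z)‖ := by
    rw [← norm_sin_mul_pi_sub_intCast z (round z.re)]
    have := two_mul_norm_le_norm_sin_pi_mul (w := z - (round z.re : ℤ))
      (by simpa using abs_sub_round z.re)
    linarith [hz (round z.re)]
  set a := |z.im| * π with ha
  have ha0 : 0 ≤ a := by positivity
  have h2 : Real.sinh a ≤ ‖Complex.sin (π * z)‖ := by
    refine (pow_le_pow_iff_left₀ (Real.sinh_nonneg_iff.2 ha0) (norm_nonneg _) two_ne_zero).1 ?_
    have h3 := norm_sin_sq (π * z)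
    rw [Complex.im_ofReal_mul] at h3
    have h4 : |Real.sinh (π * z.im)| = Real.sinh a := by
      rw [Real.abs_sinh, abs_mul, abs_of_pos Real.pi_pos, mul_comm]
    rw [h3, ← sq_abs (Real.sinh (π * z.im)), h4]
    nlinarith [sq_nonneg (Real.sin (π * z : ℂ).re)]
  have h5 : Real.exp a = Real.cosh a + Real.sinh a := (Real.cosh_add_sinh a).symm
  have h6 : Real.cosh a ≤ 1 + Real.sinh a := by
    have := Real.cosh_sub_sinh a
    have : Real.exp (-a) ≤ 1 := Real.exp_le_one_iff.2 (by linarith)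
    linarith
  linarith

theorem norm_sin_sub_self_le {w : ℂ} (hw : ‖w‖ ≤ 1) : ‖Complex.sin w - w‖ ≤ ‖w‖ ^ 2 := by
  have h1 := Complex.norm_exp_sub_one_sub_id_le (x := w * Complex.I) (by simpa using hw)
  have h2 := Complex.norm_exp_sub_one_sub_id_le (x := -w * Complex.I) (by simpa using hw)
  have h : Complex.sin w - w = ((Complex.exp (-w * Complex.I) - 1 - -w * Complex.I) -
      (Complex.exp (w * Complex.I) - 1 - w * Complex.I)) * Complex.I / 2 := by
    rw [Complex.sin]
    linear_combination -w * Complex.I_mul_I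
  rw [h, norm_div, norm_mul, Complex.norm_I, mul_one, Complex.norm_ofNat, div_le_iff₀ two_pos]
  refine (norm_sub_le _ _).trans ?_
  simp only [norm_mul, norm_neg, Complex.norm_I, mul_one] at h1 h2
  linarith

theorem norm_cos_sub_one_le {w : ℂ} (hw : ‖w‖ ≤ 1) : ‖Complex.cos w - 1‖ ≤ ‖w‖ ^ 2 := by
  have h1 := Complex.norm_exp_sub_one_sub_id_le (x := w * Complex.I) (by simpa using hw)
  have h2 := Complex.norm_exp_sub_one_sub_id_le (x := -w * Complex.I) (by simpa using hw)
  have h : Complex.cos w - 1 = ((Complex.exp (w * Complex.I) - 1 - w * Complex.I) +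
      (Complex.exp (-w * Complex.I) - 1 - -w * Complex.I)) / 2 := by
    rw [Complex.cos]
    ring
  rw [h, norm_div, Complex.norm_ofNat, div_le_iff₀ two_pos]
  refine (norm_add_le _ _).trans ?_
  simp only [norm_mul, norm_neg, Complex.norm_I, mul_one] at h1 h2
  linarith

/-- In a horizontal strip `z ↦ cos (z t)` is Lipschitz, uniformly for `t ∈ [0, π]`. -/
theorem norm_cos_mul_sub_cos_mul_le {z w : ℂ} (hz : |z.im| ≤ 1) (hw : |w.im| ≤ 1) {t : ℝ}
    (ht : t ∈ Set.Icc 0 π) :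
    ‖Complex.cos (z * t) - Complex.cos (w * t)‖ ≤ π * Real.exp π * ‖z - w‖ := by
  have hconv : Convex ℝ {z : ℂ | |z.im| ≤ 1} := by
    have : {z : ℂ | |z.im| ≤ 1} = Complex.imLm ⁻¹' Set.Icc (-1) 1 := by
      ext z; simp [abs_le]
    rw [this]
    exact (convex_Icc (-1 : ℝ) 1).linear_preimage _
  refine hconv.norm_image_sub_le_of_norm_hasDerivWithin_le (𝕜 := ℂ)
    (f := fun z : ℂ => Complex.cos (z * t)) (f' := fun z => -Complex.sin (z * t) * t)
    (fun x _ => ?_) (fun x hx => ?_) hw hz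
  · have h : HasDerivAt (fun z : ℂ => z * t) (t : ℂ) x := by
      simpa using (hasDerivAt_id x).mul_const (t : ℂ)
    exact h.ccos.hasDerivWithinAt
  · have hx : |x.im| ≤ 1 := hx
    rw [norm_mul, norm_neg, Complex.norm_real, Real.norm_eq_abs, abs_of_nonneg ht.1, mul_comm]
    have h1 : |x.im| * t ≤ π := by nlinarith [ht.1, ht.2, abs_nonneg x.im]
    have h2 := (norm_sin_mul_ofReal_le x ht.1).trans (Real.exp_le_exp.2 h1)
    exact mul_le_mul ht.2 h2 (norm_nonneg _) Real.pi_nonneg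

/-! ### Asymptotics of the characteristic function -/

section

variable {q Δ : ℝ → ℝ}

theorem IsSystemSolution.hasDerivAt (hq : IsPiecewiseContinuous q) (hΔ : IsRetardation Δ) {μ : ℂ}
    {u v : ℝ → ℂ} (h : IsSystemSolution q Δ μ u v) {x : ℝ} (hx : x ∈ Set.Ioo 0 π)
    (hne : x ≠ π / 2) :
    HasDerivAt u (v x) x ∧ HasDerivAt v (-μ ^ 2 * u x - retardedTerm q Δ u x) x := by
  refine ⟨(h.hasDerivWithinAt_fst (Set.Ioo_subset_Icc_self hx)).hasDerivAt
    (Icc_mem_nhds hx.1 hx.2), ?_⟩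
  rcases lt_or_gt_of_ne hne with h1 | h1
  · exact (h.hasDerivWithinAt_snd_left hq hΔ ⟨hx.1.le, h1⟩).hasDerivAt (Ico_mem_nhds hx.1 h1)
  · exact (h.hasDerivWithinAt_snd_right hq hΔ ⟨h1, hx.2.le⟩).hasDerivAt (Ioc_mem_nhds h1 hx.2)

theorem intervalIntegrable_mul_retardedTerm (hq : IsPiecewiseContinuous q)
    (hΔ : IsRetardation Δ) {k u : ℝ → ℂ} (hk : Continuous k) (hu : Continuous u) {x : ℝ}
    (hx : x ∈ Set.Icc 0 π) :
    IntervalIntegrable (fun τ => k τ * retardedTerm q Δ u τ) MeasureTheory.volume 0 x :=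
  (intervalIntegrable_retardedTerm_sub hq hΔ hu ⟨le_rfl, Real.pi_nonneg⟩ hx).continuousOn_mul
    hk.continuousOn

/-- Variation of constants for the solution, multiplied by `μ`. -/
theorem IsSystemSolution.mul_fst_eq (hq : IsPiecewiseContinuous q) (hΔ : IsRetardation Δ) {μ : ℂ}
    {u v : ℝ → ℂ} (h : IsSystemSolution q Δ μ u v) {x : ℝ} (hx : x ∈ Set.Icc 0 π) :
    μ * u x = μ * u 0 * Complex.cos (μ * x) + v 0 * Complex.sin (μ * x) -
      ∫ τ in (0 : ℝ)..x, Complex.sin (μ * (x - τ : ℝ)) * retardedTerm q Δ u τ := by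
  have hu := h.continuous_fst
  have hv := h.continuous_snd
  have hd : ∀ τ ∈ Set.Ioo (min 0 x) (max 0 x) \ {π / 2},
      HasDerivAt (fun τ : ℝ => μ * Complex.cos (μ * (x - τ : ℝ)) * u τ +
        Complex.sin (μ * (x - τ : ℝ)) * v τ)
        (-(Complex.sin (μ * (x - τ : ℝ)) * retardedTerm q Δ u τ)) τ := fun τ hτ => by
    rw [min_eq_left hx.1, max_eq_right hx.1] at hτ
    obtain ⟨h1, h2⟩ := h.hasDerivAt hq hΔ ⟨hτ.1.1, hτ.1.2.trans_le hx.2⟩ hτ.2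
    have h3 : HasDerivAt (fun τ : ℝ => μ * ((x - τ : ℝ) : ℂ)) (μ * ((-1 : ℝ) : ℂ)) τ :=
      (((hasDerivAt_id τ).const_sub x).ofReal_comp).const_mul μ
    have hsin := (Complex.hasDerivAt_sin (μ * ((x - τ : ℝ) : ℂ))).comp τ h3
    have hcos := (Complex.hasDerivAt_cos (μ * ((x - τ : ℝ) : ℂ))).comp τ h3
    refine (((hcos.const_mul μ).mul h1).add (hsin.mul h2)).congr_deriv ?_
    simp only [Function.comp_apply]
    push_cast
    ring
  have := MeasureTheory.integral_eq_of_hasDerivAt_off_countable _ _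
    (Set.countable_singleton (π / 2)) (Continuous.continuousOn (by fun_prop)) hd
    (intervalIntegrable_mul_retardedTerm hq hΔ (by fun_prop) hu hx).neg
  rw [intervalIntegral.integral_neg] at this
  simp only [sub_self, Complex.ofReal_zero, mul_zero, Complex.cos_zero, Complex.sin_zero,
    sub_zero] at this
  linear_combination -this

theorem IsSystemSolution.snd_eq_variation (hq : IsPiecewiseContinuous q) (hΔ : IsRetardation Δ)
    {μ : ℂ} {u v : ℝ → ℂ} (h : IsSystemSolution q Δ μ u v) {x : ℝ} (hx : x ∈ Set.Icc 0 π) :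
    v x = -μ * u 0 * Complex.sin (μ * x) + v 0 * Complex.cos (μ * x) -
      ∫ τ in (0 : ℝ)..x, Complex.cos (μ * (x - τ : ℝ)) * retardedTerm q Δ u τ := by
  have hu := h.continuous_fst
  have hv := h.continuous_snd
  have hd : ∀ τ ∈ Set.Ioo (min 0 x) (max 0 x) \ {π / 2},
      HasDerivAt (fun τ : ℝ => -μ * Complex.sin (μ * (x - τ : ℝ)) * u τ +
        Complex.cos (μ * (x - τ : ℝ)) * v τ)
        (-(Complex.cos (μ * (x - τ : ℝ)) * retardedTerm q Δ u τ)) τ := fun τ hτ => by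
    rw [min_eq_left hx.1, max_eq_right hx.1] at hτ
    obtain ⟨h1, h2⟩ := h.hasDerivAt hq hΔ ⟨hτ.1.1, hτ.1.2.trans_le hx.2⟩ hτ.2
    have h3 : HasDerivAt (fun τ : ℝ => μ * ((x - τ : ℝ) : ℂ)) (μ * ((-1 : ℝ) : ℂ)) τ :=
      (((hasDerivAt_id τ).const_sub x).ofReal_comp).const_mul μ
    have hsin := (Complex.hasDerivAt_sin (μ * ((x - τ : ℝ) : ℂ))).comp τ h3
    have hcos := (Complex.hasDerivAt_cos (μ * ((x - τ : ℝ) : ℂ))).comp τ h3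
    refine (((hsin.const_mul (-μ)).mul h1).add (hcos.mul h2)).congr_deriv ?_
    simp only [Function.comp_apply]
    push_cast
    ring
  have := MeasureTheory.integral_eq_of_hasDerivAt_off_countable _ _
    (Set.countable_singleton (π / 2)) (Continuous.continuousOn (by fun_prop)) hd
    (intervalIntegrable_mul_retardedTerm hq hΔ (by fun_prop) hu hx).neg
  rw [intervalIntegral.integral_neg] at this
  simp only [sub_self, Complex.ofReal_zero, mul_zero, Complex.cos_zero, Complex.sin_zero,
    sub_zero] at this
  linear_combination -this

theorem norm_integral_mul_retardedTerm_le (hΔ : IsRetardation Δ) {K : ℝ} (hK0 : 0 ≤ K)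
    (hK : ∀ x ∈ Set.Icc 0 π, |q x| ≤ K) {k u : ℝ → ℂ} {s M x : ℝ} (hs : 0 ≤ s) (hM : 0 ≤ M)
    (hx : x ∈ Set.Icc 0 π) (hk : ∀ τ ∈ Set.Icc 0 x, ‖k τ‖ ≤ Real.exp (s * (x - τ)))
    (hu : ∀ t ∈ Set.Icc 0 π, ‖u t‖ ≤ M * Real.exp (s * t)) :
    ‖∫ τ in (0 : ℝ)..x, k τ * retardedTerm q Δ u τ‖ ≤ K * M * π * Real.exp (s * x) := by
  have hm : MonotoneOn (fun t => M * Real.exp (s * t)) (Set.Icc 0 π) := fun a _ d _ had => by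
    simp only; gcongr
  have hb := intervalIntegral.norm_integral_le_of_norm_le_const
    (a := 0) (b := x) (f := fun τ => k τ * retardedTerm q Δ u τ)
    (C := K * M * Real.exp (s * x)) (fun τ hτ => by
      rw [Set.uIoc_of_le hx.1] at hτ
      have h1 := hk τ ⟨hτ.1.le, hτ.2⟩
      have h2 := norm_retardedTerm_le hΔ hK hm hu ⟨hτ.1.le, hτ.2.trans hx.2⟩
      rw [norm_mul]
      refine (mul_le_mul h1 h2 (norm_nonneg _) (Real.exp_pos _).le).trans_eq ?_
      have : s * x = s * (x - τ) + s * τ := by ring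
      rw [this, Real.exp_add]; ring)
  refine hb.trans ?_
  rw [sub_zero, abs_of_nonneg hx.1]
  have : 0 ≤ K * M * Real.exp (s * x) := by positivity
  nlinarith [hx.2]

/-- The exponential bound for a solution: the weighted supremum `M` of the solution satisfies
`|μ| M ≤ D + K π M`, where `D` comes from the Cauchy data, and for large `|μ|` the last term is
absorbed. -/
theorem IsSystemSolution.norm_mul_norm_fst_le (hq : IsPiecewiseContinuous q)
    (hΔ : IsRetardation Δ) {K : ℝ}
    (hK0 : 0 ≤ K) (hK : ∀ x ∈ Set.Icc 0 π, |q x| ≤ K) {μ : ℂ} {u v : ℝ → ℂ}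
    (h : IsSystemSolution q Δ μ u v) (hμ : 2 * K * π ≤ ‖μ‖) {x : ℝ} (hx : x ∈ Set.Icc 0 π) :
    ‖μ‖ * ‖u x‖ ≤ 2 * (‖μ‖ * ‖u 0‖ + ‖v 0‖) * Real.exp (|μ.im| * x) := by
  obtain ⟨x₀, hx₀, hmax⟩ := isCompact_Icc.exists_isMaxOn (⟨0, le_rfl, Real.pi_nonneg⟩ :
    (Set.Icc 0 π).Nonempty) (f := fun x => ‖u x‖ * Real.exp (-(|μ.im| * x)))
    (h.continuous_fst.norm.mul (by fun_prop)).continuousOn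
  set s := |μ.im| with hs
  have hs0 : 0 ≤ s := abs_nonneg _
  set M := ‖u x₀‖ * Real.exp (-(s * x₀)) with hM
  have hM0 : 0 ≤ M := by positivity
  have hu : ∀ t ∈ Set.Icc 0 π, ‖u t‖ ≤ M * Real.exp (s * t) := fun t ht => by
    have := hmax ht
    simp only [Set.mem_ofPred_eq] at this
    rw [Real.exp_neg, ← div_eq_mul_inv] at this
    exact (div_le_iff₀ (Real.exp_pos _)).1 this
  have hx₀u : ‖u x₀‖ = M * Real.exp (s * x₀) := by
    rw [hM, mul_assoc, ← Real.exp_add]; simp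
  have h1 := h.mul_fst_eq hq hΔ hx₀
  have h2 := norm_integral_mul_retardedTerm_le (q := q) hΔ hK0 hK hs0 hM0 hx₀
    (k := fun τ => Complex.sin (μ * (x₀ - τ : ℝ)))
    (fun τ hτ => norm_sin_mul_ofReal_le μ (sub_nonneg.2 hτ.2)) hu
  have h3 : ‖μ‖ * M ≤ (‖μ‖ * ‖u 0‖ + ‖v 0‖) + K * M * π := by
    have hc := norm_cos_mul_ofReal_le μ hx₀.1
    have hsn := norm_sin_mul_ofReal_le μ hx₀.1
    have h4 : ‖μ * u x₀‖ ≤ ((‖μ‖ * ‖u 0‖ + ‖v 0‖) + K * M * π) * Real.exp (s * x₀) := by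
      rw [h1]
      calc _ ≤ ‖μ‖ * ‖u 0‖ * ‖Complex.cos (μ * x₀)‖ + ‖v 0‖ * ‖Complex.sin (μ * x₀)‖ +
            K * M * π * Real.exp (s * x₀) := by
            refine (norm_sub_le _ _).trans (add_le_add ((norm_add_le _ _).trans_eq ?_) h2)
            simp only [norm_mul]
        _ ≤ ‖μ‖ * ‖u 0‖ * Real.exp (s * x₀) + ‖v 0‖ * Real.exp (s * x₀) +
            K * M * π * Real.exp (s * x₀) := by gcongr
        _ = _ := by ring
    rw [norm_mul, hx₀u, ← mul_assoc] at h4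
    exact le_of_mul_le_mul_right h4 (Real.exp_pos _)
  have h5 : ‖μ‖ * M ≤ 2 * (‖μ‖ * ‖u 0‖ + ‖v 0‖) := by nlinarith
  calc ‖μ‖ * ‖u x‖ ≤ ‖μ‖ * (M * Real.exp (s * x)) := by gcongr; exact hu x hx
    _ = ‖μ‖ * M * Real.exp (s * x) := by ring
    _ ≤ _ := by gcongr

/-- The integral `∫₀^π q(τ) cos μ(π - τ) cos μ(τ - Δ(τ)) dτ`, the contribution of the retarded term
to the second leading term of the characteristic function. At integers `μ` it is
`cos μπ · (P(μ) + Q(μ))`. -/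
noncomputable def retardedIntegral (q Δ : ℝ → ℝ) (μ : ℂ) : ℂ :=
  ∫ τ in (0 : ℝ)..π, Complex.cos (μ * (π - τ : ℝ)) *
    retardedTerm q Δ (fun t => Complex.cos (μ * t)) τ

/-- The characteristic function, multiplied by `δ`, up to `O(μ e^{π |Im μ|})`. The solution is
first bounded by `2 C₀ |μ| e^{x |Im μ|}` and then compared with its leading term `μ a₂' cos μx`. -/
theorem exists_expansion (hq : IsPiecewiseContinuous q) (hΔ : IsRetardation Δ)
    (a₁ a₁' a₂ a₂' b : ℝ) :
    ∃ C R : ℝ, 0 ≤ C ∧ 1 ≤ R ∧ ∀ μ : ℂ, R ≤ ‖μ‖ → ∀ u v : ℝ → ℂ, IsSystemSolution q Δ μ u v →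
      u 0 = μ * a₂' + a₂ → v 0 = μ * a₁' + a₁ →
      ‖(Real.cos b : ℂ) * u π + μ * (Real.sin b : ℂ) * v π - (Real.sin b : ℂ) *
        (-μ ^ 3 * a₂' * Complex.sin (μ * π) + μ ^ 2 * (a₁' * Complex.cos (μ * π) -
          a₂ * Complex.sin (μ * π) - a₂' * retardedIntegral q Δ μ))‖ ≤
        C * ‖μ‖ * Real.exp (|μ.im| * π) := by
  obtain ⟨K, hK0, hK⟩ := hq.exists_bound
  set C₀ := |a₂'| + |a₂| + |a₁'| + |a₁| with hC₀
  set C₁ := |a₂| + C₀ + 2 * K * C₀ * π with hC₁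
  have hC₀0 : 0 ≤ C₀ := by positivity
  have hC₁0 : 0 ≤ C₁ := by positivity
  refine ⟨2 * C₀ + |a₁| + K * C₁ * π, max 1 (2 * K * π), by positivity, le_max_left _ _, ?_⟩
  intro μ hμ u v h hu0 hv0
  have hμ1 : 1 ≤ ‖μ‖ := (le_max_left _ _).trans hμ
  have hμ2 : 2 * K * π ≤ ‖μ‖ := (le_max_right _ _).trans hμ
  have hμ0 : 0 < ‖μ‖ := by linarith
  have hu := h.continuous_fst
  set s := |μ.im| with hs
  have hs0 : 0 ≤ s := abs_nonneg _
  have hlin : ∀ a a' : ℝ, ‖μ * a' + a‖ ≤ (|a'| + |a|) * ‖μ‖ := fun a a' => by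
    refine (norm_add_le _ _).trans ?_
    rw [norm_mul, Complex.norm_real, Complex.norm_real, Real.norm_eq_abs, Real.norm_eq_abs]
    nlinarith [abs_nonneg a]
  have hu0n : ‖u 0‖ ≤ (|a₂'| + |a₂|) * ‖μ‖ := hu0 ▸ hlin a₂ a₂'
  have hv0n : ‖v 0‖ ≤ (|a₁'| + |a₁|) * ‖μ‖ := hv0 ▸ hlin a₁ a₁'
  have hv0n' : ‖v 0‖ ≤ C₀ * ‖μ‖ := hv0n.trans (by
    gcongr; rw [hC₀]; linarith [abs_nonneg a₂', abs_nonneg a₂])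
  have hub : ∀ x ∈ Set.Icc 0 π, ‖u x‖ ≤ 2 * C₀ * ‖μ‖ * Real.exp (s * x) := fun x hx => by
    have h1 := h.norm_mul_norm_fst_le hq hΔ hK0.le hK hμ2 hx
    have h2 : ‖μ‖ * ‖u 0‖ + ‖v 0‖ ≤ ‖μ‖ * (C₀ * ‖μ‖) := by
      have : (|a₁'| + |a₁|) * ‖μ‖ ≤ ‖μ‖ * ((|a₁'| + |a₁|) * ‖μ‖) :=
        le_mul_of_one_le_left (by positivity) hμ1
      have h3 : ‖μ‖ * ‖u 0‖ ≤ ‖μ‖ * ((|a₂'| + |a₂|) * ‖μ‖) := by gcongr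
      calc _ ≤ ‖μ‖ * ((|a₂'| + |a₂|) * ‖μ‖) + ‖μ‖ * ((|a₁'| + |a₁|) * ‖μ‖) :=
            add_le_add h3 (hv0n.trans this)
        _ = _ := by rw [hC₀]; ring
    refine le_of_mul_le_mul_left (h1.trans ?_) hμ0
    calc _ ≤ 2 * (‖μ‖ * (C₀ * ‖μ‖)) * Real.exp (s * x) := by gcongr
      _ = _ := by ring
  -- the remainder after the leading term of the solution
  set r : ℝ → ℂ := fun x => u x - μ * a₂' * Complex.cos (μ * x) with hr
  have hrb : ∀ x ∈ Set.Icc 0 π, ‖r x‖ ≤ C₁ * Real.exp (s * x) := fun x hx => by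
    have h1 := h.mul_fst_eq hq hΔ hx
    have h2 := norm_integral_mul_retardedTerm_le (q := q) hΔ hK0.le hK hs0
      (by positivity) hx (k := fun τ => Complex.sin (μ * (x - τ : ℝ)))
      (fun τ hτ => norm_sin_mul_ofReal_le μ (sub_nonneg.2 hτ.2)) hub
    have h3 : μ * r x = μ * a₂ * Complex.cos (μ * x) + v 0 * Complex.sin (μ * x) -
        ∫ τ in (0 : ℝ)..x, Complex.sin (μ * (x - τ : ℝ)) * retardedTerm q Δ u τ := by
      rw [hu0] at h1
      simp only [hr]
      linear_combination h1
    have hc := norm_cos_mul_ofReal_le μ hx.1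
    have hsn := norm_sin_mul_ofReal_le μ hx.1
    refine le_of_mul_le_mul_left ?_ hμ0
    rw [← norm_mul, h3]
    calc _ ≤ ‖μ‖ * |a₂| * ‖Complex.cos (μ * x)‖ + ‖v 0‖ * ‖Complex.sin (μ * x)‖ +
          K * (2 * C₀ * ‖μ‖) * π * Real.exp (s * x) := by
          refine (norm_sub_le _ _).trans (add_le_add ((norm_add_le _ _).trans_eq ?_) h2)
          simp only [norm_mul, Complex.norm_real, Real.norm_eq_abs]
      _ ≤ ‖μ‖ * |a₂| * Real.exp (s * x) + C₀ * ‖μ‖ * Real.exp (s * x) +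
          K * (2 * C₀ * ‖μ‖) * π * Real.exp (s * x) := by gcongr
      _ = _ := by rw [hC₁]; ring
  have hrc : Continuous r := by fun_prop
  have hJ := norm_integral_mul_retardedTerm_le (q := q) hΔ hK0.le hK hs0 hC₁0 pi_mem_Icc
    (k := fun τ => Complex.cos (μ * (π - τ : ℝ)))
    (fun τ hτ => norm_cos_mul_ofReal_le μ (sub_nonneg.2 hτ.2)) hrb
  set J := ∫ τ in (0 : ℝ)..π, Complex.cos (μ * (π - τ : ℝ)) * retardedTerm q Δ r τ with hJdef
  have hsplit : ∫ τ in (0 : ℝ)..π, Complex.cos (μ * (π - τ : ℝ)) * retardedTerm q Δ u τ =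
      μ * a₂' * retardedIntegral q Δ μ + J := by
    rw [retardedIntegral, hJdef, ← intervalIntegral.integral_const_mul,
      ← intervalIntegral.integral_add
        ((intervalIntegrable_mul_retardedTerm hq hΔ (by fun_prop) (by fun_prop)
          pi_mem_Icc).const_mul _)
        (intervalIntegrable_mul_retardedTerm hq hΔ (by fun_prop) hrc pi_mem_Icc)]
    refine intervalIntegral.integral_congr fun τ _ => ?_
    simp only [retardedTerm, hr]
    ring
  have hv := h.snd_eq_variation hq hΔ pi_mem_Icc
  rw [hsplit, hu0] at hv
  have hexp : (Real.cos b : ℂ) * u π + μ * (Real.sin b : ℂ) * v π - (Real.sin b : ℂ) *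
        (-μ ^ 3 * a₂' * Complex.sin (μ * π) + μ ^ 2 * (a₁' * Complex.cos (μ * π) -
          a₂ * Complex.sin (μ * π) - a₂' * retardedIntegral q Δ μ)) =
      (Real.cos b : ℂ) * u π + μ * (Real.sin b : ℂ) * (a₁ * Complex.cos (μ * π) - J) := by
    rw [hv, hv0]; ring
  rw [hexp]
  have hcb : ‖(Real.cos b : ℂ)‖ ≤ 1 := by
    rw [Complex.norm_real]; exact Real.abs_cos_le_one b
  have hsb : ‖(Real.sin b : ℂ)‖ ≤ 1 := by
    rw [Complex.norm_real]; exact Real.abs_sin_le_one b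
  have hc := norm_cos_mul_ofReal_le μ Real.pi_nonneg
  calc _ ≤ ‖(Real.cos b : ℂ)‖ * ‖u π‖ + ‖μ‖ * ‖(Real.sin b : ℂ)‖ *
        (|a₁| * ‖Complex.cos (μ * π)‖ + ‖J‖) := by
        refine (norm_add_le _ _).trans ?_
        simp only [norm_mul]
        gcongr
        refine (norm_sub_le _ _).trans ?_
        simp only [norm_mul, Complex.norm_real, Real.norm_eq_abs, le_refl]
    _ ≤ 1 * (2 * C₀ * ‖μ‖ * Real.exp (s * π)) + ‖μ‖ * 1 *
        (|a₁| * Real.exp (s * π) + K * C₁ * π * Real.exp (s * π)) := by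
        gcongr
        exact hub π pi_mem_Icc
    _ = _ := by ring

theorem exists_norm_retardedIntegral_le (hq : IsPiecewiseContinuous q) (hΔ : IsRetardation Δ) :
    ∃ C : ℝ, 0 ≤ C ∧ ∀ μ : ℂ, ‖retardedIntegral q Δ μ‖ ≤ C * Real.exp (|μ.im| * π) := by
  obtain ⟨K, hK0, hK⟩ := hq.exists_bound
  refine ⟨K * 1 * π, by positivity, fun μ => ?_⟩
  exact norm_integral_mul_retardedTerm_le (q := q) hΔ hK0.le hK (abs_nonneg _) zero_le_one
    pi_mem_Icc (fun τ hτ => norm_cos_mul_ofReal_le μ (sub_nonneg.2 hτ.2))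
    (fun t ht => by rw [one_mul]; exact norm_cos_mul_ofReal_le μ ht.1)

theorem exists_norm_retardedIntegral_sub_le (hq : IsPiecewiseContinuous q)
    (hΔ : IsRetardation Δ) :
    ∃ C : ℝ, 0 ≤ C ∧ ∀ z w : ℂ, |z.im| ≤ 1 → |w.im| ≤ 1 →
      ‖retardedIntegral q Δ z - retardedIntegral q Δ w‖ ≤ C * ‖z - w‖ := by
  obtain ⟨K, hK0, hK⟩ := hq.exists_bound
  set L := π * Real.exp π
  refine ⟨2 * K * Real.exp π * L * π, by positivity, fun z w hz hw => ?_⟩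
  rw [retardedIntegral, retardedIntegral, ← intervalIntegral.integral_sub
    (intervalIntegrable_mul_retardedTerm hq hΔ (by fun_prop) (by fun_prop) pi_mem_Icc)
    (intervalIntegrable_mul_retardedTerm hq hΔ (by fun_prop) (by fun_prop) pi_mem_Icc)]
  have hb := intervalIntegral.norm_integral_le_of_norm_le_const
    (a := 0) (b := π) (f := fun τ => Complex.cos (z * (π - τ : ℝ)) *
      retardedTerm q Δ (fun t => Complex.cos (z * t)) τ - Complex.cos (w * (π - τ : ℝ)) *
      retardedTerm q Δ (fun t => Complex.cos (w * t)) τ)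
    (C := 2 * K * Real.exp π * L * ‖z - w‖) (fun τ hτ => by
      rw [Set.uIoc_of_le Real.pi_nonneg] at hτ
      have hτ' : τ ∈ Set.Icc 0 π := ⟨hτ.1.le, hτ.2⟩
      have hm := hΔ.retardedArg_mem hτ'
      have hm' : retardedArg Δ τ ∈ Set.Icc 0 π := ⟨hm.1, hm.2.trans hτ.2⟩
      have hp : π - τ ∈ Set.Icc 0 π := ⟨by linarith [hτ.2], by linarith [hτ.1]⟩
      have hbd : ∀ y : ℂ, |y.im| ≤ 1 → ∀ t ∈ Set.Icc 0 π, ‖Complex.cos (y * (t : ℝ))‖ ≤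
          Real.exp π := fun y hy t ht => (norm_cos_mul_ofReal_le y ht.1).trans
        (Real.exp_le_exp.2 (by nlinarith [ht.1, ht.2, abs_nonneg y.im]))
      have e1 := norm_cos_mul_sub_cos_mul_le hz hw hp
      have e2 := norm_cos_mul_sub_cos_mul_le hz hw hm'
      have e3 := hbd z hz _ hm'
      have e4 := hbd w hw _ hp
      have hqK : ‖(q τ : ℂ)‖ ≤ K := by rw [Complex.norm_real]; exact hK τ hτ'
      have hid : Complex.cos (z * (π - τ : ℝ)) *
          retardedTerm q Δ (fun t => Complex.cos (z * t)) τ - Complex.cos (w * (π - τ : ℝ)) *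
          retardedTerm q Δ (fun t => Complex.cos (w * t)) τ =
          q τ * ((Complex.cos (z * (π - τ : ℝ)) - Complex.cos (w * (π - τ : ℝ))) *
            Complex.cos (z * (retardedArg Δ τ : ℝ)) + Complex.cos (w * (π - τ : ℝ)) *
            (Complex.cos (z * (retardedArg Δ τ : ℝ)) -
              Complex.cos (w * (retardedArg Δ τ : ℝ)))) := by
        simp only [retardedTerm]; ring
      rw [hid, norm_mul]
      calc _ ≤ K * (L * ‖z - w‖ * Real.exp π + Real.exp π * (L * ‖z - w‖)) := by
            refine mul_le_mul hqK ((norm_add_le _ _).trans ?_) (norm_nonneg _) hK0.le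
            rw [norm_mul, norm_mul]
            gcongr
        _ = _ := by ring)
  refine hb.trans_eq ?_
  rw [sub_zero, abs_of_pos Real.pi_pos]
  ring

theorem retardedIntegral_intCast (hq : IsPiecewiseContinuous q) (hΔ : IsRetardation Δ) (m : ℤ) :
    retardedIntegral q Δ m =
      (Real.cos (m * π) * (coefP q Δ m + coefQ q Δ m) : ℝ) := by
  have hP := hq.intervalIntegrable_mul_cos hΔ.piecewise 0 m
  have hQ := hq.intervalIntegrable_mul_cos hΔ.piecewise (2 * m) (-m)
  have h1 : coefP q Δ m + coefQ q Δ m = ∫ θ in (0 : ℝ)..π, 1 / 2 *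
      (q θ * Real.cos (0 * θ + m * Δ θ) + q θ * Real.cos (2 * m * θ + -m * Δ θ)) := by
    rw [intervalIntegral.integral_const_mul, intervalIntegral.integral_add hP hQ, coefP, coefQ,
      mul_add]
    congr 3 <;> (funext θ; ring_nf)
  rw [h1, ← intervalIntegral.integral_const_mul, ← intervalIntegral.integral_ofReal,
    retardedIntegral]
  refine intervalIntegral.integral_congr_ae ?_
  filter_upwards [MeasureTheory.Measure.ae_ne MeasureTheory.volume (π / 2)] with τ hτ _
  have hs : Real.sin (m * π) = 0 := Real.sin_int_mul_pi m
  have e1 : Real.cos (m * (π - τ)) = Real.cos (m * π) * Real.cos (m * τ) := by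
    rw [mul_sub, Real.cos_sub, hs]; ring
  have e2 : Real.cos (0 * τ + m * Δ τ) + Real.cos (2 * m * τ + -m * Δ τ) =
      2 * (Real.cos (m * τ) * Real.cos (m * (τ - Δ τ))) := by
    have a1 : 0 * τ + m * Δ τ = m * τ - m * (τ - Δ τ) := by ring
    have a2 : 2 * m * τ + -m * Δ τ = m * τ + m * (τ - Δ τ) := by ring
    rw [a1, a2, Real.cos_sub, Real.cos_add]; ring
  have e3 : Real.cos (m * π) * (1 / 2 * (q τ * Real.cos (0 * τ + m * Δ τ) +
      q τ * Real.cos (2 * m * τ + -m * Δ τ))) =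
      Real.cos (m * (π - τ)) * (q τ * Real.cos (m * (τ - Δ τ))) := by
    rw [← mul_add, e2, e1]; ring
  rw [e3, retardedTerm, retardedArg_of_ne hτ]
  push_cast
  ring

end

/-! ### Rouché's theorem on circles for entire functions -/

theorem Differentiable.exists_eq_pow_mul {f : ℂ → ℂ} (hf : Differentiable ℂ f) {a : ℂ} {n : ℕ}
    (hn : analyticOrderAt f a = n) :
    ∃ g : ℂ → ℂ, Differentiable ℂ g ∧ (∀ z, f z = (z - a) ^ n * g z) ∧ g a ≠ 0 := by
  induction n generalizing f with
  | zero =>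
    refine ⟨f, hf, fun z => by simp, ?_⟩
    exact (hf.analyticAt a).analyticOrderAt_eq_zero.1 (by simpa using hn)
  | succ n ih =>
    have h0 : f a = 0 := apply_eq_zero_of_analyticOrderAt_ne_zero (by simp [hn])
    have hd : Differentiable ℂ (dslope f a) := differentiableOn_univ.1
      ((Complex.differentiableOn_dslope Filter.univ_mem).2 hf.differentiableOn)
    have hfd : f = (fun z => z - a) * dslope f a := by
      funext z
      have := sub_smul_dslope f a z
      simp only [smul_eq_mul, h0, sub_zero] at this
      simp [this]
    have ho : analyticOrderAt (dslope f a) a = n := by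
      have h1 : analyticOrderAt f a = 1 + analyticOrderAt (dslope f a) a := by
        conv_lhs => rw [hfd]
        rw [analyticOrderAt_mul (by fun_prop) (hd.analyticAt a), analyticOrderAt_id_sub_const_self]
      rw [hn, Nat.cast_succ, add_comm] at h1
      exact (WithTop.add_left_cancel ENat.one_ne_top h1).symm
    obtain ⟨g, hg, hfg, hga⟩ := ih hd ho
    refine ⟨g, hg, fun z => ?_, hga⟩
    rw [congrFun hfd z, Pi.mul_apply, hfg z]
    ring

/-- Finitely many zeros of an entire function can be divided out, with their multiplicities. -/
theorem Differentiable.exists_eq_prod_mul {f : ℂ → ℂ} (hf : Differentiable ℂ f)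
    (hne : ∀ z, analyticOrderAt f z ≠ ⊤) (T : Finset ℂ) :
    ∃ g : ℂ → ℂ, Differentiable ℂ g ∧
      (∀ z, f z = (∏ a ∈ T, (z - a) ^ analyticOrderNatAt f a) * g z) ∧ ∀ a ∈ T, g a ≠ 0 := by
  classical
  induction T using Finset.induction_on with
  | empty => exact ⟨f, hf, by simp, by simp⟩
  | insert a T ha ih =>
    obtain ⟨g, hg, hfg, hgT⟩ := ih
    set p : ℂ → ℂ := fun z => ∏ a ∈ T, (z - a) ^ analyticOrderNatAt f a with hp
    have hpd : Differentiable ℂ p := by fun_prop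
    have hpa : p a ≠ 0 := by
      refine Finset.prod_ne_zero_iff.2 fun t ht => pow_ne_zero _ (sub_ne_zero.2 ?_)
      rintro rfl; exact ha ht
    have hga : analyticOrderAt g a = analyticOrderNatAt f a := by
      have hfpg : f = p * g := funext hfg
      have h1 := analyticOrderAt_mul (hpd.analyticAt a) (hg.analyticAt a)
      rw [← hfpg, (hpd.analyticAt a).analyticOrderAt_eq_zero.2 hpa, zero_add] at h1
      rw [← h1, Nat.cast_analyticOrderNatAt (hne a)]
    obtain ⟨k, hk, hgk, hka⟩ := hg.exists_eq_pow_mul hga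
    refine ⟨k, hk, fun z => ?_, fun t ht => ?_⟩
    · rw [Finset.prod_insert ha, hfg z, hgk z]
      ring
    · rcases Finset.mem_insert.1 ht with rfl | ht
      · exact hka
      · intro h0
        exact hgT t ht (by rw [hgk t, h0, mul_zero])

theorem Differentiable.finite_zeros {f : ℂ → ℂ} (hf : Differentiable ℂ f)
    (hne : ∀ z, analyticOrderAt f z ≠ ⊤) {K : Set ℂ} (hK : IsCompact K) :
    {z ∈ K | f z = 0}.Finite := by
  by_contra hinf
  obtain ⟨x, -, hx⟩ := Set.Infinite.exists_accPt_of_subset_isCompact hinf hK (Set.sep_subset _ _)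
  have hfr : ∃ᶠ z in 𝓝[≠] x, f z = 0 :=
    (accPt_iff_frequently_nhdsNE.1 hx).mono fun z hz => hz.2
  refine hne x (analyticOrderAt_eq_top.2 ?_)
  exact (hf.analyticAt x).frequently_zero_iff_eventually_zero.1 hfr

theorem circleIntegral_logDeriv_prod_mul {T : Finset ℂ} (ν : ℂ → ℕ) {g : ℂ → ℂ}
    (hg : Differentiable ℂ g) {c : ℂ} {r : ℝ} (hr : 0 < r) (hT : ∀ a ∈ T, a ∈ Metric.ball c r)
    (hg0 : ∀ z ∈ Metric.closedBall c r, g z ≠ 0) :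
    ∮ z in C(c, r), logDeriv (fun z => (∏ a ∈ T, (z - a) ^ ν a) * g z) z =
      2 * π * Complex.I * ∑ a ∈ T, (ν a : ℂ) := by
  have hsub : ∀ z ∈ Metric.sphere c r, ∀ a ∈ T, z - a ≠ 0 := fun z hz a ha => by
    refine sub_ne_zero.2 ?_
    rintro rfl
    exact (Metric.mem_ball.1 (hT _ ha)).ne (Metric.mem_sphere.1 hz)
  have hld : Set.EqOn (logDeriv fun z => (∏ a ∈ T, (z - a) ^ ν a) * g z)
      (fun z => (∑ a ∈ T, (ν a : ℂ) * (z - a)⁻¹) + logDeriv g z) (Metric.sphere c r) :=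
    fun z hz => by
      have hgz := hg0 z (Metric.sphere_subset_closedBall hz)
      have hz' := hsub z hz
      rw [logDeriv_mul z (Finset.prod_ne_zero_iff.2 fun a ha => pow_ne_zero _ (hz' a ha)) hgz
          (by fun_prop) (hg z), logDeriv_prod (f := fun a z => (z - a) ^ ν a)
          (fun a ha => pow_ne_zero _ (hz' a ha))
          (fun a _ => by fun_prop)]
      congr 1
      refine Finset.sum_congr rfl fun a _ => ?_
      rw [logDeriv_fun_pow (by fun_prop)]
      simp [logDeriv_apply]
  have hgd : ∀ z ∈ Metric.closedBall c r, DifferentiableAt ℂ (logDeriv g) z := fun z hz =>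
    (hg.analyticAt z).deriv.differentiableAt.div (hg z) (hg0 z hz)
  have hgc : ContinuousOn (logDeriv g) (Metric.closedBall c r) := fun z hz =>
    (hgd z hz).continuousAt.continuousWithinAt
  have hic : ∀ a ∈ T, CircleIntegrable (fun z => (ν a : ℂ) * (z - a)⁻¹) c r := fun a ha =>
    ContinuousOn.circleIntegrable hr.le (continuousOn_const.mul
      ((continuousOn_id.sub continuousOn_const).inv₀ fun z hz => hsub z hz a ha))
  rw [circleIntegral.integral_congr hr.le hld, circleIntegral.integral_add
      (CircleIntegrable.fun_sum T hic)
      (ContinuousOn.circleIntegrable hr.le (hgc.mono Metric.sphere_subset_closedBall)),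
    circleIntegral.integral_fun_sum hic,
    Complex.circleIntegral_eq_zero_of_differentiable_on_off_countable hr.le
      Set.countable_empty hgc
      (fun z hz => hgd z (Metric.ball_subset_closedBall hz.1)), add_zero, Finset.mul_sum]
  refine Finset.sum_congr rfl fun a ha => ?_
  rw [circleIntegral.integral_const_mul, circleIntegral.integral_sub_inv_of_mem_ball (hT a ha)]
  ring

/-- The argument principle for a circle: the logarithmic derivative counts the zeros in the
disc. -/
theorem Differentiable.exists_multiset_zeros {f : ℂ → ℂ} (hf : Differentiable ℂ f) {c : ℂ} {r : ℝ}
    (hr : 0 < r) (hs : ∀ z ∈ Metric.sphere c r, f z ≠ 0) :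
    ∃ S : Multiset ℂ, (∀ z ∈ S, z ∈ Metric.ball c r) ∧
      (∀ z ∈ Metric.ball c r, (S.count z : ℕ∞) = analyticOrderAt f z) ∧
      ∮ z in C(c, r), logDeriv f z = 2 * π * Complex.I * S.card := by
  classical
  have hne : ∀ z, analyticOrderAt f z ≠ ⊤ := fun z hz => by
    have h0 : f = 0 := (hf.differentiableOn.analyticOnNhd isOpen_univ).eq_of_eventuallyEq
      (g := 0) (z₀ := z) (fun _ _ => analyticAt_const) (analyticOrderAt_eq_top.1 hz)
    obtain ⟨w, hw⟩ := (NormedSpace.sphere_nonempty (x := c) (r := r)).2 hr.le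
    exact hs w hw (by rw [h0]; rfl)
  have hfin := hf.finite_zeros hne (isCompact_closedBall c r)
  set T := hfin.toFinset with hT
  have hmem : ∀ z ∈ T, z ∈ Metric.ball c r := fun z hz => by
    obtain ⟨h1, h2⟩ : z ∈ Metric.closedBall c r ∧ f z = 0 := by simpa [hT] using hz
    rcases (Metric.mem_closedBall.1 h1).lt_or_eq with h | h
    · exact h
    · exact absurd h2 (hs z h)
  obtain ⟨g, hg, hfg, hgT⟩ := hf.exists_eq_prod_mul hne T
  have hg0 : ∀ z ∈ Metric.closedBall c r, g z ≠ 0 := fun z hz h0 => by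
    refine hgT z ?_ h0
    simp only [hT, Set.Finite.mem_toFinset]
    exact ⟨hz, by rw [hfg z, h0, mul_zero]⟩
  have hcount : ∀ z, (∑ a ∈ T, Multiset.replicate (analyticOrderNatAt f a) a).count z =
      if z ∈ T then analyticOrderNatAt f z else 0 := fun z => by
    rw [Multiset.count_sum']
    simp only [Multiset.count_replicate]
    rw [Finset.sum_ite_eq']
  refine ⟨∑ a ∈ T, Multiset.replicate (analyticOrderNatAt f a) a, fun z hz => ?_, fun z hz => ?_,
    ?_⟩
  · obtain ⟨a, ha, hza⟩ := Multiset.mem_sum.1 hz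
    rw [Multiset.eq_of_mem_replicate hza]
    exact hmem a ha
  · rw [hcount]
    split_ifs with h
    · exact Nat.cast_analyticOrderNatAt (hne z)
    · rw [Nat.cast_zero, eq_comm, (hf.analyticAt z).analyticOrderAt_eq_zero]
      intro h0
      exact h (by simpa [hT] using ⟨(Metric.mem_ball.1 hz).le, h0⟩)
  · have h := circleIntegral_logDeriv_prod_mul (analyticOrderNatAt f) hg hr hmem hg0
    rw [← funext hfg] at h
    rw [h, Multiset.card_sum]
    simp

/-- Rouché's theorem for a circle. On the circle `f / g` stays in the slit plane, so that its
logarithm is a primitive of `f' / f - g' / g`. -/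
theorem card_zeros_eq_of_norm_sub_lt {f g : ℂ → ℂ} (hf : Differentiable ℂ f)
    (hg : Differentiable ℂ g) {c : ℂ} {r : ℝ} (hr : 0 < r)
    (hfg : ∀ z ∈ Metric.sphere c r, ‖f z - g z‖ < ‖g z‖) {S : Multiset ℂ}
    (hS : ∀ z ∈ S, z ∈ Metric.ball c r)
    (hSg : ∀ z ∈ Metric.ball c r, (S.count z : ℕ∞) = analyticOrderAt g z) :
    ∃ S' : Multiset ℂ, (∀ z ∈ S', z ∈ Metric.ball c r) ∧
      (∀ z ∈ Metric.ball c r, (S'.count z : ℕ∞) = analyticOrderAt f z) ∧ S'.card = S.card := by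
  have hg0 : ∀ z ∈ Metric.sphere c r, g z ≠ 0 := fun z hz =>
    norm_pos_iff.1 ((norm_nonneg _).trans_lt (hfg z hz))
  have hf0 : ∀ z ∈ Metric.sphere c r, f z ≠ 0 := fun z hz h0 => by
    have := hfg z hz
    simp [h0] at this
  obtain ⟨S', h1, h2, h3⟩ := hf.exists_multiset_zeros hr hf0
  obtain ⟨S'', k1, k2, k3⟩ := hg.exists_multiset_zeros hr hg0
  have hSS : S'' = S := by
    classical
    ext z
    by_cases hz : z ∈ Metric.ball c r
    · exact_mod_cast (k2 z hz).trans (hSg z hz).symm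
    · rw [Multiset.count_eq_zero_of_notMem fun h => hz (k1 z h),
        Multiset.count_eq_zero_of_notMem fun h => hz (hS z h)]
  have hlog : ∮ z in C(c, r), (logDeriv f z - logDeriv g z) = 0 := by
    refine circleIntegral.integral_eq_zero_of_hasDerivWithinAt
      (f := fun z => Complex.log (f z / g z)) hr.le fun z hz => HasDerivAt.hasDerivWithinAt ?_
    have hslit : f z / g z ∈ Complex.slitPlane := by
      have h : ‖f z / g z - 1‖ < 1 := by
        rw [div_sub_one (hg0 z hz), norm_div, div_lt_one (norm_pos_iff.2 (hg0 z hz))]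
        exact hfg z hz
      simpa using Complex.mem_slitPlane_of_norm_lt_one h
    refine (((hf z).hasDerivAt.div (hg z).hasDerivAt (hg0 z hz)).clog hslit).congr_deriv ?_
    have := hg0 z hz
    have := hf0 z hz
    simp only [logDeriv_apply, Pi.div_apply]
    field_simp
  have hci : ∀ {k : ℂ → ℂ}, Differentiable ℂ k → (∀ z ∈ Metric.sphere c r, k z ≠ 0) →
      CircleIntegrable (logDeriv k) c r := fun {k} hk hk0 =>
    ContinuousOn.circleIntegrable hr.le fun z hz =>
      ((hk.analyticAt z).deriv.differentiableAt.div (hk z)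
        (hk0 z hz)).continuousAt.continuousWithinAt
  rw [circleIntegral.integral_sub (hci hf hf0) (hci hg hg0), h3, k3, sub_eq_zero] at hlog
  refine ⟨S', h1, h2, ?_⟩
  have := mul_left_cancel₀ Complex.two_pi_I_ne_zero hlog
  rw [← hSS]
  exact_mod_cast this

/-! ### Zeros of functions asymptotic to `κ μ³ sin πμ` -/

theorem analyticOrderAt_sin_pi_mul (z : ℂ) [Decidable (∃ n : ℤ, z = n)] :
    analyticOrderAt (fun μ : ℂ => Complex.sin (π * μ)) z = if ∃ n : ℤ, z = n then 1 else 0 := by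
  have hpi : (π : ℂ) ≠ 0 := by exact_mod_cast Real.pi_ne_zero
  have hd : Differentiable ℂ fun μ : ℂ => Complex.sin (π * μ) := by fun_prop
  have ha : AnalyticAt ℂ (fun μ : ℂ => Complex.sin (π * μ)) z := hd.analyticAt z
  have hiff : Complex.sin (π * z) = 0 ↔ ∃ n : ℤ, z = n := by
    rw [Complex.sin_eq_zero_iff]
    refine exists_congr fun n => ?_
    rw [mul_comm, mul_left_inj' hpi]
  split_ifs with h
  · have h0 := hiff.2 h
    refine ha.analyticOrderAt_eq_one_of_zero_deriv_ne_zero h0 ?_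
    have hd' : HasDerivAt (fun μ : ℂ => Complex.sin (π * μ)) (Complex.cos (π * z) * (π * 1)) z :=
      ((hasDerivAt_id z).const_mul (π : ℂ)).csin
    rw [hd'.deriv, mul_one]
    refine mul_ne_zero (fun hc => ?_) hpi
    have := Complex.sin_sq_add_cos_sq (π * z)
    rw [h0, hc] at this
    norm_num at this
  · exact ha.analyticOrderAt_eq_zero.2 fun h0 => h (hiff.1 h0)

/-- The model `κ μ³ sin πμ` has a fourfold zero at `0` and simple zeros at the other integers. -/
theorem analyticOrderAt_model {κ : ℂ} (hκ : κ ≠ 0) (z : ℂ) [Decidable (∃ n : ℤ, z = n)] :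
    analyticOrderAt (fun μ : ℂ => κ * μ ^ 3 * Complex.sin (π * μ)) z =
      (if z = 0 then 3 else 0) + if ∃ n : ℤ, z = n then 1 else 0 := by
  have h1 : Differentiable ℂ fun μ : ℂ => κ * μ ^ 3 := by fun_prop
  have h2 : Differentiable ℂ fun μ : ℂ => Complex.sin (π * μ) := by fun_prop
  have h3 : (fun μ : ℂ => κ * μ ^ 3 * Complex.sin (π * μ)) =
      (fun μ : ℂ => κ * μ ^ 3) * fun μ : ℂ => Complex.sin (π * μ) := rfl
  rw [h3, analyticOrderAt_mul (h1.analyticAt z) (h2.analyticAt z), analyticOrderAt_sin_pi_mul]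
  congr 1
  split_ifs with h
  · subst h
    have := (h1.analyticAt 0).analyticOrderAt_eq_natCast (n := 3)
    exact this.2 ⟨fun _ => κ, analyticAt_const, hκ,
      Filter.Eventually.of_forall fun z => by simp [mul_comm]⟩
  · exact (h1.analyticAt z).analyticOrderAt_eq_zero.2 (mul_ne_zero hκ (pow_ne_zero 3 h))

theorem count_map_intCast_Icc (N : ℕ) {z : ℂ} (hz : ‖z‖ < N + 1 / 2)
    [Decidable (∃ n : ℤ, z = n)] :
    ((Finset.Icc (-N : ℤ) N).val.map fun n : ℤ => (n : ℂ)).count z =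
      if ∃ n : ℤ, z = n then 1 else 0 := by
  have hinj : Function.Injective fun n : ℤ => (n : ℂ) := Int.cast_injective
  split_ifs with h
  · obtain ⟨n, rfl⟩ := h
    rw [Multiset.count_map_eq_count' _ _ hinj]
    refine Multiset.count_eq_one_of_mem (Finset.nodup _) ?_
    rw [Complex.norm_intCast] at hz
    have h1 : |n| < (N : ℤ) + 1 := by
      have : |(n : ℝ)| < (N : ℝ) + 1 := by linarith
      exact_mod_cast this
    rw [Finset.mem_val, Finset.mem_Icc]
    exact abs_le.1 (by lia)
  · refine Multiset.count_eq_zero_of_notMem fun hm => ?_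
    obtain ⟨n, -, hn⟩ := Multiset.mem_map.1 hm
    exact h ⟨n, hn.symm⟩

theorem norm_intCast_sub_intCast_ge_one {m n : ℤ} (h : m ≠ n) : 1 ≤ ‖(m : ℂ) - n‖ := by
  rw [← Int.cast_sub, Complex.norm_intCast]
  exact_mod_cast Int.one_le_abs (sub_ne_zero.2 h)

theorem intCast_unique_of_norm_lt {z : ℂ} {m n : ℤ} (hm : ‖z - m‖ < 1 / 2) (hn : ‖z - n‖ < 1 / 2) :
    m = n := by
  by_contra h
  have h1 := norm_intCast_sub_intCast_ge_one h
  have h2 : (m : ℂ) - n = (z - n) - (z - m) := by ring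
  rw [h2] at h1
  linarith [norm_sub_le (z - n) (z - m)]

/-- If `F = κ μ³ sin πμ + O(μ² e^{π|Im μ|})`, then for some `N` the disc `|μ| < N + 1/2` holds
`2 N + 4` zeros of `F`, and the other zeros are simple, one near each integer `m` with
`|m| > N`. -/
theorem exists_zeros_of_asymptotics {F : ℂ → ℂ} (hF : Differentiable ℂ F) {κ : ℂ} (hκ : κ ≠ 0)
    {C R : ℝ} (hC : ∀ μ : ℂ, R ≤ ‖μ‖ → ‖F μ - κ * μ ^ 3 * Complex.sin (π * μ)‖ ≤
      C * ‖μ‖ ^ 2 * Real.exp (|μ.im| * π)) :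
    ∃ (N : ℕ) (S : Multiset ℂ) (ζ : ℤ → ℂ), S.card = 2 * (N + 2) ∧
      (∀ z ∈ S, ‖z‖ < N + 1 / 2) ∧
      (∀ z : ℂ, ‖z‖ < N + 1 / 2 → (S.count z : ℕ∞) = analyticOrderAt F z) ∧
      (∀ m : ℤ, (N : ℤ) < |m| → ‖ζ m - m‖ < 1 / 4 ∧ analyticOrderAt F (ζ m) = 1) ∧
      ∀ z : ℂ, F z = 0 → N + 1 / 2 ≤ ‖z‖ → ∃ m : ℤ, (N : ℤ) < |m| ∧ z = ζ m := by
  classical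
  set G : ℂ → ℂ := fun μ => κ * μ ^ 3 * Complex.sin (π * μ) with hG
  have hGd : Differentiable ℂ G := by fun_prop
  have hκ0 : 0 < ‖κ‖ := norm_pos_iff.2 hκ
  obtain ⟨N, hN⟩ := exists_nat_gt (max R (max 1 (4 * C / ‖κ‖)))
  have hNR : R < N := (le_max_left _ _).trans_lt hN
  have hN1 : (1 : ℝ) < N := ((le_max_left _ _).trans (le_max_right _ _)).trans_lt hN
  have hNC : 4 * C / ‖κ‖ < N := ((le_max_right _ _).trans (le_max_right _ _)).trans_lt hN
  have hdom : ∀ z : ℂ, (N : ℝ) ≤ ‖z‖ → (∀ n : ℤ, 1 / 4 ≤ ‖z - n‖) → ‖F z - G z‖ < ‖G z‖ :=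
    fun z hz hd => by
      have h1 := hC z (hNR.le.trans hz)
      have h2 := exp_le_four_mul_norm_sin hd
      have hz0 : 0 < ‖z‖ := by linarith
      have h3 : 4 * C < ‖κ‖ * ‖z‖ := by
        rw [div_lt_iff₀ hκ0] at hNC
        nlinarith
      refine h1.trans_lt ?_
      have h4 : 0 < Real.exp (|z.im| * π) := Real.exp_pos _
      rw [hG]
      simp only [norm_mul, norm_pow]
      calc C * ‖z‖ ^ 2 * Real.exp (|z.im| * π) = 4 * C * (‖z‖ ^ 2 * Real.exp (|z.im| * π) / 4) := by
            ring
        _ < ‖κ‖ * ‖z‖ * (‖z‖ ^ 2 * Real.exp (|z.im| * π) / 4) := by gcongr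
        _ = ‖κ‖ * ‖z‖ ^ 3 * (Real.exp (|z.im| * π) / 4) := by ring
        _ ≤ ‖κ‖ * ‖z‖ ^ 3 * ‖Complex.sin (π * z)‖ := by gcongr; linarith
  -- the disc around the origin
  obtain ⟨S, hS1, hS2, hS3⟩ := card_zeros_eq_of_norm_sub_lt (c := 0) (r := N + 1 / 2) hF hGd
    (by positivity) (fun z hz => by
      rw [mem_sphere_zero_iff_norm] at hz
      refine hdom z (by linarith) fun n => ?_
      have h1 := abs_norm_sub_norm_le z n
      rw [hz, Complex.norm_intCast] at h1
      refine le_trans ?_ h1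
      rw [le_abs]
      rcases le_or_gt |n| (N : ℤ) with h | h
      · have : |(n : ℝ)| ≤ N := by exact_mod_cast h
        left; linarith
      · have : (N : ℝ) + 1 ≤ |(n : ℝ)| := by exact_mod_cast h
        right; linarith)
    (S := Multiset.replicate 3 0 + (Finset.Icc (-N : ℤ) N).val.map fun n : ℤ => (n : ℂ))
    (fun z hz => by
      rw [mem_ball_zero_iff]
      rcases Multiset.mem_add.1 hz with h | h
      · rw [Multiset.eq_of_mem_replicate h, norm_zero]; positivity
      · obtain ⟨n, hn, rfl⟩ := Multiset.mem_map.1 h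
        rw [Finset.mem_val, Finset.mem_Icc] at hn
        rw [Complex.norm_intCast]
        have : |(n : ℝ)| ≤ N := by exact_mod_cast abs_le.2 hn
        linarith)
    (fun z hz => by
      rw [mem_ball_zero_iff] at hz
      rw [Multiset.count_add, count_map_intCast_Icc N hz, Multiset.count_replicate,
        analyticOrderAt_model hκ]
      simp only [eq_comm (a := (0 : ℂ))]
      split_ifs <;> norm_num)
  -- the discs around the large integers
  have hdisc : ∀ m : ℤ, (N : ℤ) < |m| → ∃ w : ℂ, ‖w - m‖ < 1 / 4 ∧ analyticOrderAt F w = 1 ∧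
      ∀ z : ℂ, ‖z - m‖ < 1 / 4 → F z = 0 → z = w := fun m hm => by
    have hmN : (N : ℝ) + 1 ≤ |(m : ℝ)| := by exact_mod_cast hm
    have hm0 : m ≠ 0 := by
      rintro rfl
      rw [abs_zero] at hm
      lia
    obtain ⟨T, hT1, hT2, hT3⟩ := card_zeros_eq_of_norm_sub_lt (c := (m : ℂ)) (r := 1 / 4) hF hGd
      (by norm_num) (fun z hz => by
        rw [mem_sphere_iff_norm] at hz
        refine hdom z ?_ fun n => ?_
        · have h1 := norm_sub_norm_le (m : ℂ) z
          rw [norm_sub_rev, hz, Complex.norm_intCast] at h1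
          linarith
        · by_contra hlt
          have := intCast_unique_of_norm_lt (z := z) (m := m) (n := n) (by linarith) (by linarith)
          subst this
          linarith)
      (S := {(m : ℂ)})
      (fun z hz => by
        rw [Multiset.mem_singleton.1 hz]
        exact Metric.mem_ball_self (by norm_num))
      (fun z hz => by
        rw [mem_ball_iff_norm] at hz
        have hz0 : z ≠ 0 := by
          rintro rfl
          rw [zero_sub, norm_neg, Complex.norm_intCast] at hz
          linarith
        rw [analyticOrderAt_model hκ, if_neg hz0, zero_add, Multiset.count_singleton]
        by_cases hzm : z = m
        · rw [if_pos hzm, if_pos ⟨m, hzm⟩, Nat.cast_one]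
        · rw [if_neg hzm, if_neg, Nat.cast_zero]
          rintro ⟨n, rfl⟩
          have := intCast_unique_of_norm_lt (z := (n : ℂ)) (m := m) (n := n) (by linarith)
            (by simp)
          exact hzm (by rw [this]))
    rw [Multiset.card_singleton] at hT3
    obtain ⟨w, rfl⟩ := Multiset.card_eq_one.1 hT3
    have hw := hT1 w (Multiset.mem_singleton_self w)
    refine ⟨w, mem_ball_iff_norm.1 hw, ?_, fun z hz hz0 => ?_⟩
    · rw [← hT2 w hw, Multiset.count_singleton_self, Nat.cast_one]
    · have h1 := hT2 z (mem_ball_iff_norm.2 hz)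
      by_contra hne
      rw [Multiset.count_singleton, if_neg hne, Nat.cast_zero, eq_comm,
        (hF.analyticAt z).analyticOrderAt_eq_zero] at h1
      exact h1 hz0
  choose! ζ hζ1 hζ2 hζ3 using hdisc
  refine ⟨N, S, ζ, ?_, fun z hz => mem_ball_zero_iff.1 (hS1 z hz),
    fun z hz => hS2 z (mem_ball_zero_iff.2 hz), fun m hm => ⟨hζ1 m hm, hζ2 m hm⟩,
    fun z hz hzN => ?_⟩
  · rw [hS3, Multiset.card_add, Multiset.card_replicate, Multiset.card_map, Finset.card_val,
      Int.card_Icc]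
    lia
  · obtain ⟨m, hm⟩ : ∃ m : ℤ, ‖z - m‖ < 1 / 4 := by
      by_contra hcon
      push Not at hcon
      have := hdom z (by linarith) hcon
      rw [hz, zero_sub, norm_neg] at this
      exact lt_irrefl _ this
    have hmN : (N : ℤ) < |m| := by
      have h1 := norm_sub_norm_le z m
      rw [Complex.norm_intCast] at h1
      have : (N : ℝ) < |(m : ℝ)| := by linarith
      exact_mod_cast this
    exact ⟨m, hmN, hζ3 m hmN z hm hz⟩

/-! ### Enumeration of the zeros -/

theorem exists_map_univ_eq {ι : Type*} [Fintype ι] (S : Multiset ℂ) (h : S.card = Fintype.card ι) :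
    ∃ e : ι → ℂ, Finset.univ.val.map e = S := by
  classical
  have hc : Fintype.card ι = Fintype.card S.ToType := by rw [Multiset.card_coe, h]
  let φ := Fintype.equivOfCardEq hc
  refine ⟨fun i => (φ i).1, ?_⟩
  conv_rhs => rw [← Multiset.map_univ_coe S]
  rw [← Finset.map_univ_equiv φ, Finset.map_val, Multiset.map_map]
  rfl

/-- The indices `s n` with `n ≥ 2` are determined by the integers `s (n - 1)` they belong to. -/
theorem unit_mul_injective {s t : ℤˣ} {n k : ℕ} (hn : 1 < n) (hk : 1 < k)
    (h : (s : ℤ) * ((n : ℤ) - 1) = (t : ℤ) * ((k : ℤ) - 1)) : s = t ∧ n = k := by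
  rcases Int.units_eq_one_or s with rfl | rfl <;> rcases Int.units_eq_one_or t with rfl | rfl <;>
    simp only [Units.val_one, Units.val_neg] at h
  · exact ⟨rfl, by lia⟩
  · lia
  · lia
  · exact ⟨rfl, by lia⟩

theorem exists_unit_mul_eq {m : ℤ} (hm : m ≠ 0) :
    ∃ s : ℤˣ, m = (s : ℤ) * (((m.natAbs + 1 : ℕ) : ℤ) - 1) := by
  rcases lt_or_gt_of_ne hm with h | h
  · exact ⟨-1, by simp only [Units.val_neg, Units.val_one]; lia⟩
  · exact ⟨1, by simp only [Units.val_one]; lia⟩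

/-- The zeros in the disc, `2 (N + 2)` in number, take the indices `(s, n)` with `n ≤ N + 1`; the
simple zero near `s (n - 1)` takes the index `(s, n)` for larger `n`. -/
theorem exists_enumeration {F : ℂ → ℂ} (hF : Differentiable ℂ F) {N : ℕ} {S : Multiset ℂ}
    {ζ : ℤ → ℂ} (hcard : S.card = 2 * (N + 2)) (hS : ∀ z ∈ S, ‖z‖ < N + 1 / 2)
    (hcount : ∀ z : ℂ, ‖z‖ < N + 1 / 2 → (S.count z : ℕ∞) = analyticOrderAt F z)
    (hζ : ∀ m : ℤ, (N : ℤ) < |m| → ‖ζ m - m‖ < 1 / 4 ∧ analyticOrderAt F (ζ m) = 1)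
    (hall : ∀ z : ℂ, F z = 0 → N + 1 / 2 ≤ ‖z‖ → ∃ m : ℤ, (N : ℤ) < |m| ∧ z = ζ m) :
    ∃ μ : ℤˣ × ℕ → ℂ, (∀ z : ℂ, {i | μ i = z}.encard = analyticOrderAt F z) ∧
      ∀ (s : ℤˣ) (n : ℕ), N + 2 ≤ n → μ (s, n) = ζ ((s : ℤ) * ((n : ℤ) - 1)) := by
  classical
  obtain ⟨e, he⟩ := exists_map_univ_eq (ι := ℤˣ × Fin (N + 2)) S (by
    rw [hcard, Fintype.card_prod, Fintype.card_fin]; rfl)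
  have heS : ∀ j, e j ∈ S := fun j => by
    rw [← he]; exact Multiset.mem_map_of_mem e (Finset.mem_univ_val j)
  set μ : ℤˣ × ℕ → ℂ := fun i => if h : i.2 < N + 2 then e (i.1, ⟨i.2, h⟩) else
    ζ ((i.1 : ℤ) * ((i.2 : ℤ) - 1)) with hμ
  have hsmall : ∀ (i : ℤˣ × ℕ) (h : i.2 < N + 2), μ i = e (i.1, ⟨i.2, h⟩) := fun i h => dif_pos h
  have hlarge : ∀ i : ℤˣ × ℕ, ¬ i.2 < N + 2 → μ i = ζ ((i.1 : ℤ) * ((i.2 : ℤ) - 1)) :=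
    fun i h => dif_neg h
  have habs : ∀ i : ℤˣ × ℕ, ¬ i.2 < N + 2 → (N : ℤ) < |(i.1 : ℤ) * ((i.2 : ℤ) - 1)| :=
    fun i h => by
      rw [abs_mul, Int.isUnit_iff_abs_eq.1 i.1.isUnit, one_mul]
      exact lt_of_lt_of_le (by lia) (le_abs_self _)
  have hζN : ∀ m : ℤ, (N : ℤ) < |m| → N + 1 / 2 < ‖ζ m‖ := fun m hm => by
    have h1 := norm_sub_norm_le (m : ℂ) (ζ m)
    rw [norm_sub_rev, Complex.norm_intCast] at h1
    have h2 : (N : ℝ) + 1 ≤ |(m : ℝ)| := by exact_mod_cast hm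
    linarith [(hζ m hm).1]
  refine ⟨μ, fun z => ?_, fun s n hn => hlarge (s, n) (by simpa using hn)⟩
  rcases lt_or_ge ‖z‖ (N + 1 / 2) with hz | hz
  · rw [← hcount z hz, ← he, Multiset.count_map]
    have hset : {i | μ i = z} = (fun j : ℤˣ × Fin (N + 2) => (j.1, (j.2 : ℕ))) ''
        (Finset.univ.filter fun j => z = e j : Finset (ℤˣ × Fin (N + 2))) := by
      ext i
      simp only [Set.mem_ofPred_eq, Set.mem_image, Finset.coe_filter, Finset.mem_univ, true_and]
      constructor
      · intro hi
        by_cases h : i.2 < N + 2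
        · exact ⟨(i.1, ⟨i.2, h⟩), by rw [← hi, hsmall i h], rfl⟩
        · rw [hlarge i h] at hi
          have := hζN _ (habs i h)
          rw [hi] at this
          linarith
      · rintro ⟨j, hj, rfl⟩
        rw [hsmall _ j.2.2, hj]
    rw [hset, Function.Injective.encard_image, Set.encard_coe_eq_coe_finsetCard]
    · rfl
    · rintro ⟨s, n⟩ ⟨t, k⟩ h
      simp only [Prod.mk.injEq, Fin.val_inj] at h
      exact Prod.ext h.1 h.2
  · have hns : ∀ i, μ i = z → ¬ i.2 < N + 2 := fun i hi h => by
      have := hS _ (heS (i.1, ⟨i.2, h⟩))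
      rw [← hsmall i h, hi] at this
      linarith
    by_cases hz0 : F z = 0
    · obtain ⟨m, hm, rfl⟩ := hall z hz0 hz
      have hm0 : m ≠ 0 := by
        rintro rfl
        rw [abs_zero] at hm
        lia
      have hm' : N < m.natAbs := by
        rw [Int.abs_eq_natAbs] at hm
        exact_mod_cast hm
      obtain ⟨s, hs⟩ := exists_unit_mul_eq hm0
      have hset : {i | μ i = ζ m} = {(s, m.natAbs + 1)} := by
        ext i
        simp only [Set.mem_ofPred_eq, Set.mem_singleton_iff]
        constructor
        · intro hi
          have h := hns i hi
          rw [hlarge i h] at hi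
          have h1 := (hζ _ (habs i h)).1
          rw [hi] at h1
          have h2 := intCast_unique_of_norm_lt (h1.trans (by norm_num))
            ((hζ m hm).1.trans (by norm_num))
          have h3 := unit_mul_injective (by lia) (by lia) (h2.trans hs)
          exact Prod.ext h3.1 h3.2
        · rintro rfl
          rw [hlarge _ (by simp only; lia), ← hs]
      rw [hset, Set.encard_singleton, (hζ m hm).2]
    · have hset : {i | μ i = z} = ∅ := by
        ext i
        simp only [Set.mem_ofPred_eq, Set.mem_empty_iff_false, iff_false]
        intro hi
        have h := hns i hi
        rw [hlarge i h] at hi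
        have h1 := (hζ _ (habs i h)).2
        rw [hi, (hF.analyticAt z).analyticOrderAt_eq_zero.2 hz0] at h1
        exact zero_ne_one h1
      rw [hset, Set.encard_empty, (hF.analyticAt z).analyticOrderAt_eq_zero.2 hz0]

/-! ### Localisation of the zeros and the asymptotic formula -/

section

variable {q Δ : ℝ → ℝ}

theorem exists_endValue_expansion (hq : IsPiecewiseContinuous q) (hΔ : IsRetardation Δ)
    (a₁ a₁' a₂ a₂' b : ℝ) {δ : ℝ} (hδ : δ ≠ 0) :
    ∃ C R : ℝ, 0 ≤ C ∧ 1 ≤ R ∧ ∀ μ : ℂ, R ≤ ‖μ‖ →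
      ‖(δ : ℂ) * endValue hq hΔ b δ μ (μ * a₂' + a₂) (μ * a₁' + a₁) - (Real.sin b : ℂ) *
        (-μ ^ 3 * a₂' * Complex.sin (μ * π) + μ ^ 2 * (a₁' * Complex.cos (μ * π) -
          a₂ * Complex.sin (μ * π) - a₂' * retardedIntegral q Δ μ))‖ ≤
        C * ‖μ‖ * Real.exp (|μ.im| * π) := by
  have hδ' : (δ : ℂ) ≠ 0 := by exact_mod_cast hδ
  obtain ⟨C, R, hC, hR, h⟩ := exists_expansion hq hΔ a₁ a₁' a₂ a₂' b
  refine ⟨C, R, hC, hR, fun μ hμ => ?_⟩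
  obtain ⟨hs, hA, hB⟩ := isSystemSolution_systemSolution hq hΔ μ (μ * a₂' + a₂) (μ * a₁' + a₁)
  have := h μ hμ _ _ hs hA hB
  rwa [endValue, mul_div_cancel₀ _ hδ']

/-- The leading term of the characteristic function. -/
theorem exists_norm_endValue_sub_model_le (hq : IsPiecewiseContinuous q) (hΔ : IsRetardation Δ)
    (a₁ a₁' a₂ a₂' b : ℝ) {δ : ℝ} (hδ : δ ≠ 0) :
    ∃ C R : ℝ, ∀ μ : ℂ, R ≤ ‖μ‖ →
      ‖endValue hq hΔ b δ μ (μ * a₂' + a₂) (μ * a₁' + a₁) -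
        (-(Real.sin b * a₂' / δ) : ℂ) * μ ^ 3 * Complex.sin (π * μ)‖ ≤
        C * ‖μ‖ ^ 2 * Real.exp (|μ.im| * π) := by
  have hδ' : (δ : ℂ) ≠ 0 := by exact_mod_cast hδ
  obtain ⟨C, R, hC, hR, h⟩ := exists_endValue_expansion hq hΔ a₁ a₁' a₂ a₂' b hδ
  obtain ⟨D, hD, hI⟩ := exists_norm_retardedIntegral_le hq hΔ
  refine ⟨(C + (|a₁'| + |a₂| + |a₂'| * D)) / |δ|, R, fun μ hμ => ?_⟩
  have h1 := h μ hμ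
  set E := Real.exp (|μ.im| * π) with hE
  have hE0 : 0 < E := Real.exp_pos _
  set W := endValue hq hΔ b δ μ (μ * a₂' + a₂) (μ * a₁' + a₁) with hW
  set X := (a₁' * Complex.cos (μ * π) - a₂ * Complex.sin (μ * π) - a₂' * retardedIntegral q Δ μ)
    with hX
  have hXb : ‖X‖ ≤ (|a₁'| + |a₂| + |a₂'| * D) * E := by
    have hc := norm_cos_mul_ofReal_le μ Real.pi_nonneg
    have hs := norm_sin_mul_ofReal_le μ Real.pi_nonneg
    calc ‖X‖ ≤ |a₁'| * ‖Complex.cos (μ * π)‖ + |a₂| * ‖Complex.sin (μ * π)‖ +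
          |a₂'| * ‖retardedIntegral q Δ μ‖ := by
          refine (norm_sub_le _ _).trans (add_le_add ((norm_sub_le _ _).trans_eq ?_) ?_)
          · simp only [norm_mul, Complex.norm_real, Real.norm_eq_abs]
          · simp only [norm_mul, Complex.norm_real, Real.norm_eq_abs, le_refl]
      _ ≤ |a₁'| * E + |a₂| * E + |a₂'| * (D * E) := by gcongr; exact hI μ
      _ = _ := by ring
  have hid : W - (-(Real.sin b * a₂' / δ) : ℂ) * μ ^ 3 * Complex.sin (π * μ) =
      (((δ : ℂ) * W - (Real.sin b : ℂ) * (-μ ^ 3 * a₂' * Complex.sin (μ * π) + μ ^ 2 * X)) +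
        (Real.sin b : ℂ) * μ ^ 2 * X) / δ := by
    rw [mul_comm (π : ℂ) μ]
    field_simp
    ring
  have hsb : ‖(Real.sin b : ℂ)‖ ≤ 1 := by
    rw [Complex.norm_real]; exact Real.abs_sin_le_one b
  have hμ1 : 1 ≤ ‖μ‖ := hR.trans hμ
  rw [hid, norm_div, Complex.norm_real, Real.norm_eq_abs, div_mul_eq_mul_div, div_mul_eq_mul_div]
  gcongr
  refine (norm_add_le _ _).trans ?_
  have h2 : ‖(Real.sin b : ℂ) * μ ^ 2 * X‖ ≤
      1 * ‖μ‖ ^ 2 * ((|a₁'| + |a₂| + |a₂'| * D) * E) := by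
    rw [norm_mul, norm_mul, norm_pow]
    gcongr
  have h3 : C * ‖μ‖ * E ≤ C * ‖μ‖ ^ 2 * E := by
    gcongr
    nlinarith
  linarith

/-- Linearisation at an integer `m`. If `X` is the second order expansion at `z = m + ε`, then
multiplication by the sign `cos mπ` turns it into `-m A π ε + a₁' - A T`, up to terms of the size of
`ε` and `m ε²`. -/
theorem norm_linearised_le {z X I : ℂ} {m : ℤ} {A a₁' a₂ T D L B : ℝ} (hB : 0 ≤ B)
    (hL : 0 ≤ L) (hm : m ≠ 0) (hε : ‖z - m‖ ≤ 1 / 4)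
    (hX : X = -z * A * Complex.sin (z * π) + a₁' * Complex.cos (z * π) -
      a₂ * Complex.sin (z * π) - A * I)
    (hXD : ‖X‖ ≤ D / |(m : ℝ)|) (hεB : ‖z - m‖ ≤ B / |(m : ℝ)|)
    (hI : ‖I - (Real.cos (m * π) * T : ℝ)‖ ≤ L * ‖z - m‖) :
    ‖-(m : ℂ) * A * π * (z - m) + a₁' - A * T‖ ≤
      (D + (|A| * (2 * π + π ^ 2 * B) + |a₁'| * π ^ 2 + |a₂| * (2 * π) + |A| * L) * B) /
        |(m : ℝ)| := by
  set ε := z - m with hεdef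
  have hmpos : 0 < |(m : ℝ)| := abs_pos.2 (by exact_mod_cast hm)
  have hpi := Real.pi_pos
  set σ : ℂ := ((Real.cos (m * π) : ℝ) : ℂ) with hσ
  have hσ1 : ‖σ‖ = 1 := by
    rw [hσ, Complex.norm_real, Real.norm_eq_abs, Real.abs_cos_int_mul_pi]
  have hσ2 : σ * σ = 1 := by
    have h1 := Real.sin_sq_add_cos_sq (m * π)
    rw [Real.sin_int_mul_pi, zero_pow two_ne_zero, zero_add, sq] at h1
    rw [hσ, ← Complex.ofReal_mul, h1, Complex.ofReal_one]
  have hsm : Complex.sin (m * π) = 0 := Complex.sin_int_mul_pi m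
  have hcm : Complex.cos (m * π) = σ := by rw [hσ]; push_cast; rfl
  have hz : z * π = m * π + ε * π := by rw [hεdef]; ring
  have hsz : Complex.sin (z * π) = σ * Complex.sin (ε * π) := by
    rw [hz, Complex.sin_add, hsm, hcm]; ring
  have hcz : Complex.cos (z * π) = σ * Complex.cos (ε * π) := by
    rw [hz, Complex.cos_add, hsm, hcm]; ring
  have hw : ‖ε * π‖ = π * ‖ε‖ := by
    rw [norm_mul, Complex.norm_real, Real.norm_eq_abs, abs_of_pos hpi, mul_comm]
  have hw1 : ‖ε * π‖ ≤ 1 := by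
    rw [hw]; nlinarith [Real.pi_le_four]
  set e := ‖ε‖ with he
  have he0 : 0 ≤ e := norm_nonneg _
  have hs1 := norm_sin_sub_self_le hw1
  have hc1 := norm_cos_sub_one_le hw1
  rw [hw] at hs1 hc1 hw1
  have hsin : ‖Complex.sin (ε * π)‖ ≤ 2 * π * e := by
    have h1 : Complex.sin (ε * π) = (Complex.sin (ε * π) - ε * π) + ε * π := by ring
    rw [h1]
    refine (norm_add_le _ _).trans ?_
    rw [hw]
    nlinarith [mul_nonneg hpi.le he0]
  have hid : -(m : ℂ) * A * π * ε + a₁' - A * T = σ * X + A * (ε * Complex.sin (ε * π)) +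
      A * m * (Complex.sin (ε * π) - ε * π) - a₁' * (Complex.cos (ε * π) - 1) +
      a₂ * Complex.sin (ε * π) + A * (σ * (I - σ * T)) := by
    rw [hX, hsz, hcz]
    have hz' : z = m + ε := by rw [hεdef]; ring
    rw [hz']
    linear_combination (-(A : ℂ) * T + (m + ε) * A * Complex.sin (ε * π) -
      a₁' * Complex.cos (ε * π) + a₂ * Complex.sin (ε * π) + A * T * 2) * hσ2
  have hI' : ‖I - σ * T‖ ≤ L * e := by
    rw [hσ, ← Complex.ofReal_mul]; exact hI
  have hme : |(m : ℝ)| * e ≤ B := by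
    rw [mul_comm]; exact (le_div_iff₀ hmpos).1 hεB
  have hee : e * e ≤ e := by nlinarith
  rw [hid]
  calc _ ≤ ‖X‖ + |A| * (e * ‖Complex.sin (ε * π)‖) +
        |A| * |(m : ℝ)| * ‖Complex.sin (ε * π) - ε * π‖ + |a₁'| * ‖Complex.cos (ε * π) - 1‖ +
        |a₂| * ‖Complex.sin (ε * π)‖ + |A| * ‖I - σ * T‖ := by
        refine (norm_add_le _ _).trans (add_le_add ((norm_add_le _ _).trans
          (add_le_add ((norm_sub_le _ _).trans (add_le_add ((norm_add_le _ _).trans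
          (add_le_add ((norm_add_le _ _).trans (add_le_add ?_ ?_)) ?_)) ?_)) ?_)) ?_) <;>
          simp only [norm_mul, hσ1, one_mul, Complex.norm_real, Real.norm_eq_abs,
            Complex.norm_intCast, le_refl, he]
    _ ≤ D / |(m : ℝ)| + |A| * (e * (2 * π * e)) + |A| * |(m : ℝ)| * (π * e) ^ 2 +
        |a₁'| * (π * e) ^ 2 + |a₂| * (2 * π * e) + |A| * (L * e) := by gcongr
    _ = D / |(m : ℝ)| + |A| * (2 * π) * (e * e) + |A| * π ^ 2 * (|(m : ℝ)| * e) * e +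
        |a₁'| * π ^ 2 * (e * e) + |a₂| * (2 * π) * e + |A| * (L * e) := by ring
    _ ≤ D / |(m : ℝ)| + |A| * (2 * π) * e + |A| * π ^ 2 * B * e +
        |a₁'| * π ^ 2 * e + |a₂| * (2 * π) * e + |A| * (L * e) := by gcongr
    _ = D / |(m : ℝ)| + (|A| * (2 * π + π ^ 2 * B) + |a₁'| * π ^ 2 + |a₂| * (2 * π) + |A| * L) *
        e := by ring
    _ ≤ D / |(m : ℝ)| + (|A| * (2 * π + π ^ 2 * B) + |a₁'| * π ^ 2 + |a₂| * (2 * π) + |A| * L) *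
        (B / |(m : ℝ)|) := by gcongr
    _ = _ := by ring

/-- The asymptotic formula for a zero of the characteristic function close to a large integer. -/
theorem exists_norm_zero_sub_le (hq : IsPiecewiseContinuous q) (hΔ : IsRetardation Δ)
    (a₁ a₁' a₂ : ℝ) {a₂' b δ : ℝ} (ha₂' : a₂' ≠ 0) (hb : Real.sin b ≠ 0) (hδ : δ ≠ 0) :
    ∃ C R : ℝ, ∀ m : ℤ, R ≤ |(m : ℝ)| → ∀ z : ℂ, ‖z - m‖ ≤ 1 / 4 →
      endValue hq hΔ b δ z (z * a₂' + a₂) (z * a₁' + a₁) = 0 →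
      ‖z - ((m - 1 / (m * π) * (-(a₁' / a₂') + coefP q Δ m + coefQ q Δ m) : ℝ) : ℂ)‖ ≤
        C / (m : ℝ) ^ 2 := by
  obtain ⟨C, R, hC, hR, h⟩ := exists_endValue_expansion hq hΔ a₁ a₁' a₂ a₂' b hδ
  obtain ⟨M, hM, hI⟩ := exists_norm_retardedIntegral_le hq hΔ
  obtain ⟨L, hL, hIL⟩ := exists_norm_retardedIntegral_sub_le hq hΔ
  set e₀ := Real.exp π with he₀
  have he₀0 : 0 < e₀ := Real.exp_pos _
  set D := 2 * (C * e₀ / |Real.sin b|) with hD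
  have hD0 : 0 ≤ D := by positivity
  set B := ((|a₁'| + |a₂| + |a₂'| * M) * e₀ + D) / |a₂'| with hB
  have hB0 : 0 ≤ B := by positivity
  set C' := D + (|a₂'| * (2 * π + π ^ 2 * B) + |a₁'| * π ^ 2 + |a₂| * (2 * π) + |a₂'| * L) * B
    with hC'
  refine ⟨C' / (|a₂'| * π), R + 1, fun m hmR z hzm hz0 => ?_⟩
  have hm1 : 1 ≤ |(m : ℝ)| := by linarith
  have hmpos : 0 < |(m : ℝ)| := by linarith
  have hm0' : (m : ℝ) ≠ 0 := abs_pos.1 hmpos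
  have hm0 : m ≠ 0 := by exact_mod_cast hm0'
  have hpi := Real.pi_pos
  have hznorm : |(m : ℝ)| - 1 / 4 ≤ ‖z‖ := by
    have h1 := norm_sub_norm_le (m : ℂ) z
    rw [norm_sub_rev, Complex.norm_intCast] at h1
    linarith
  have hz2 : |(m : ℝ)| / 2 ≤ ‖z‖ := by linarith
  have hzpos : 0 < ‖z‖ := by linarith
  have him : |z.im| ≤ 1 := by
    have h1 := Complex.abs_im_le_norm (z - m)
    rw [Complex.sub_im, Complex.intCast_im, sub_zero] at h1
    linarith
  have hE : Real.exp (|z.im| * π) ≤ e₀ := Real.exp_le_exp.2 (by nlinarith)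
  set X : ℂ := -z * a₂' * Complex.sin (z * π) + a₁' * Complex.cos (z * π) -
      a₂ * Complex.sin (z * π) - a₂' * retardedIntegral q Δ z with hX
  have hXz : ‖z‖ * ‖X‖ ≤ C * e₀ / |Real.sin b| := by
    have h1 := h z (by linarith)
    have h2 : (δ : ℂ) * endValue hq hΔ b δ z (z * a₂' + a₂) (z * a₁' + a₁) - (Real.sin b : ℂ) *
        (-z ^ 3 * a₂' * Complex.sin (z * π) + z ^ 2 * (a₁' * Complex.cos (z * π) -
          a₂ * Complex.sin (z * π) - a₂' * retardedIntegral q Δ z)) =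
        -((Real.sin b : ℂ) * (z ^ 2 * X)) := by
      rw [hz0, hX]; ring
    rw [h2, norm_neg, norm_mul, norm_mul, norm_pow, Complex.norm_real, Real.norm_eq_abs] at h1
    rw [le_div_iff₀ (abs_pos.2 hb)]
    refine le_of_mul_le_mul_left ?_ hzpos
    calc _ = |Real.sin b| * (‖z‖ ^ 2 * ‖X‖) := by ring
      _ ≤ C * ‖z‖ * Real.exp (|z.im| * π) := h1
      _ ≤ C * ‖z‖ * e₀ := by gcongr
      _ = _ := by ring
  have hXD : ‖X‖ ≤ D / |(m : ℝ)| := by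
    rw [le_div_iff₀ hmpos]
    have : |(m : ℝ)| / 2 * ‖X‖ ≤ ‖z‖ * ‖X‖ := by gcongr
    rw [hD]; linarith
  have hXD' : ‖X‖ ≤ D := hXD.trans (div_le_self hD0 hm1)
  have hs : ‖Complex.sin (z * π)‖ ≤ e₀ := (norm_sin_mul_ofReal_le z hpi.le).trans hE
  have hc : ‖Complex.cos (z * π)‖ ≤ e₀ := (norm_cos_mul_ofReal_le z hpi.le).trans hE
  have hεB : ‖z - m‖ ≤ B / |(m : ℝ)| := by
    have h1 : ‖z‖ * |a₂'| * ‖Complex.sin (z * π)‖ ≤ (|a₁'| + |a₂| + |a₂'| * M) * e₀ + D := by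
      have h2 : z * a₂' * Complex.sin (z * π) = a₁' * Complex.cos (z * π) -
          a₂ * Complex.sin (z * π) - a₂' * retardedIntegral q Δ z - X := by rw [hX]; ring
      calc _ = ‖z * a₂' * Complex.sin (z * π)‖ := by
            simp only [norm_mul, Complex.norm_real, Real.norm_eq_abs]
        _ ≤ |a₁'| * ‖Complex.cos (z * π)‖ + |a₂| * ‖Complex.sin (z * π)‖ +
            |a₂'| * ‖retardedIntegral q Δ z‖ + ‖X‖ := by
            rw [h2]
            refine (norm_sub_le _ _).trans (add_le_add ((norm_sub_le _ _).trans
              (add_le_add ((norm_sub_le _ _).trans (add_le_add ?_ ?_)) ?_)) le_rfl) <;>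
              simp only [norm_mul, Complex.norm_real, Real.norm_eq_abs, le_refl]
        _ ≤ |a₁'| * e₀ + |a₂| * e₀ + |a₂'| * (M * e₀) + D := by
            gcongr
            exact (hI z).trans (by gcongr)
        _ = _ := by ring
    have h3 : 2 * ‖z - m‖ ≤ ‖Complex.sin (z * π)‖ := by
      rw [mul_comm z, ← norm_sin_mul_pi_sub_intCast z m]
      exact two_mul_norm_le_norm_sin_pi_mul
        ((Complex.abs_re_le_norm _).trans (hzm.trans (by norm_num)))
    rw [le_div_iff₀ hmpos, hB, le_div_iff₀ (abs_pos.2 ha₂')]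
    refine le_trans ?_ h1
    calc _ = |(m : ℝ)| / 2 * |a₂'| * (2 * ‖z - m‖) := by ring
      _ ≤ _ := by gcongr
  have hIm : ‖retardedIntegral q Δ z -
      (Real.cos (m * π) * (coefP q Δ m + coefQ q Δ m) : ℝ)‖ ≤ L * ‖z - m‖ := by
    rw [← retardedIntegral_intCast hq hΔ]
    exact hIL z m him (by simp)
  have key := norm_linearised_le hB0 hL hm0 hzm hX hXD hεB hIm
  have ha : (a₂' : ℂ) ≠ 0 := by exact_mod_cast ha₂'
  have hmc : (m : ℂ) ≠ 0 := by exact_mod_cast hm0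
  have hpc : (π : ℂ) ≠ 0 := by exact_mod_cast hpi.ne'
  have hid : z - ((m - 1 / (m * π) * (-(a₁' / a₂') + coefP q Δ m + coefQ q Δ m) : ℝ) : ℂ) =
      -(-(m : ℂ) * a₂' * π * (z - m) + a₁' - a₂' * ((coefP q Δ m + coefQ q Δ m : ℝ) : ℂ)) /
        (m * a₂' * π) := by
    push_cast
    field_simp
    ring
  rw [hid, norm_div, norm_neg, norm_mul, norm_mul, Complex.norm_intCast, Complex.norm_real,
    Complex.norm_real, Real.norm_eq_abs, Real.norm_eq_abs, abs_of_pos hpi]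
  calc _ ≤ C' / |(m : ℝ)| / (|(m : ℝ)| * |a₂'| * π) := by gcongr
    _ = C' / (|a₂'| * π) / (|(m : ℝ)| * |(m : ℝ)|) := by field_simp
    _ = _ := by rw [abs_mul_abs_self, sq]

end

theorem theorem1 (q Δ : ℝ → ℝ) (a₁ a₁' a₂ a₂' b δ : ℝ)
    (hq : IsPiecewiseContinuous q) (hΔ : IsRetardation Δ)
    (ha₂' : a₂' ≠ 0) (hb : Real.sin b ≠ 0) (hδ : δ ≠ 0) :
    ∃ F : ℂ → ℂ, IsCharacteristicFunction q Δ a₁ a₁' a₂ a₂' b δ F ∧ Differentiable ℂ F ∧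
      -- an enumeration `μ (s, n) = μ_{s n}` of the eigenvalues, by `±0, ±1, ±2, …`
      ∃ μ : ℤˣ × ℕ → ℂ,
        (∀ z : ℂ, IsEigenvalue q Δ a₁ a₁' a₂ a₂' b δ z ↔ ∃ i, μ i = z) ∧
        -- each eigenvalue is repeated according to its multiplicity as a zero of `F`
        (∀ z : ℂ, {i | μ i = z}.encard = analyticOrderAt F z) ∧
        ∀ s : ℤˣ,
          (fun n : ℕ => μ (s, n) -
            ((unperturbed s n - 1 / (unperturbed s n * π) *
              (-(a₁' / a₂') + coefP q Δ (unperturbed s n) + coefQ q Δ (unperturbed s n)) : ℝ) : ℂ))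
            =O[Filter.atTop] (fun n : ℕ => 1 / (n : ℝ) ^ 2) := by
  set F : ℂ → ℂ := fun μ => endValue hq hΔ b δ μ (μ * a₂' + a₂) (μ * a₁' + a₁) with hFdef
  have hF : Differentiable ℂ F :=
    differentiable_endValue hq hΔ b δ (by fun_prop) (by fun_prop)
  have hκ : (-(Real.sin b * a₂' / δ) : ℂ) ≠ 0 := by
    refine neg_ne_zero.2 (div_ne_zero (mul_ne_zero ?_ ?_) ?_) <;> exact_mod_cast ‹_›
  obtain ⟨C, R, hC⟩ := exists_norm_endValue_sub_model_le hq hΔ a₁ a₁' a₂ a₂' b hδ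
  obtain ⟨N, S, ζ, hcard, hS, hcount, hζ, hall⟩ := exists_zeros_of_asymptotics hF hκ hC
  obtain ⟨μ, hμ, hμζ⟩ := exists_enumeration hF hcard hS hcount hζ hall
  refine ⟨F, isCharacteristicFunction_endValue hq hΔ b a₁ a₁' a₂ a₂' hδ, hF, μ, fun z => ?_, hμ,
    fun s => ?_⟩
  · have h1 : (∃ i, μ i = z) ↔ {i | μ i = z}.encard ≠ 0 := by
      rw [Set.encard_ne_zero]; rfl
    rw [isEigenvalue_iff_endValue_eq_zero hq hΔ b a₁ a₁' a₂ a₂' hδ, h1, hμ,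
      (hF.analyticAt z).analyticOrderAt_ne_zero]
  · obtain ⟨C', R', h⟩ := exists_norm_zero_sub_le hq hΔ a₁ a₁' a₂ ha₂' hb hδ
    obtain ⟨K, hK⟩ := exists_nat_ge (max R' 0)
    refine Asymptotics.IsBigO.of_bound (4 * |C'|) ?_
    filter_upwards [Filter.eventually_ge_atTop (N + K + 2)] with n hn
    set m : ℤ := (s : ℤ) * ((n : ℤ) - 1) with hm
    have hun : unperturbed s n = (m : ℝ) := by
      rw [unperturbed, if_neg (by lia), hm]; push_cast; rfl
    have habs : |m| = (n : ℤ) - 1 := by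
      rw [hm, abs_mul, Int.isUnit_iff_abs_eq.1 s.isUnit, one_mul, abs_of_nonneg (by lia)]
    have habs' : |(m : ℝ)| = (n : ℝ) - 1 := by exact_mod_cast congrArg (Int.cast (R := ℝ)) habs
    have hn2 : (2 : ℝ) ≤ n := by exact_mod_cast (by lia : 2 ≤ n)
    have hnK : (K : ℝ) + 1 ≤ n := by exact_mod_cast (by lia : K + 1 ≤ n)
    obtain ⟨h1, h2⟩ := hζ m (by lia)
    have hzero : F (ζ m) = 0 := apply_eq_zero_of_analyticOrderAt_ne_zero (by rw [h2]; simp)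
    have h3 := h m (by rw [habs']; linarith [le_max_left R' 0]) (ζ m) h1.le hzero
    rw [hμζ s n (by lia), hun, norm_div, norm_one, norm_pow, Real.norm_natCast]
    refine h3.trans ?_
    have hsq : (n : ℝ) ^ 2 / 4 ≤ (m : ℝ) ^ 2 := by
      rw [← sq_abs (m : ℝ), habs']; nlinarith
    calc C' / (m : ℝ) ^ 2 ≤ |C'| / ((n : ℝ) ^ 2 / 4) :=
          div_le_div₀ (abs_nonneg _) (le_abs_self _) (by positivity) hsq
      _ = _ := by field_simp
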